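/- **Proposition 2.9 (Green's second formula).** Let $\mathbb G=(\mathbb R^N,\circ)$ be a homogeneous Carnot group: a Lie group for which there is a decomposition $\mathbb R^N=\mathbb R^{N_1}\times\dots\times\mathbb R^{N_r}$ such that for every $\lambda>0$ the dilation $\delta_\lambda(x^{(1)},\dots,x^{(r)})=(\lambda x^{(1)},\dots,\lambda^r x^{(r)})$ is an automorphism of $\mathbb G$, and such that, if $X_1,\dots,X_{N_1}$ are the left-invariant vector fields with $X_k(0)=\partial_{x_k}|_0$, the iterated commutators of $X_1,\dots,X_{N_1}$ span $\mathbb R^N$ at every point. Assume that the homogeneous dimension $Q=\sum_{k=1}^r kN_k$ is at least $3$. Put $$\mathcal L=\sum_{k=1}^{N_1}X_k^2,\qquad d\nu=dx_1\wedge\dots\wedge dx_N,\qquad \widetilde\nabla f=\sum_{k=1}^{N_1}(X_kf)X_k,\qquad \langle\widetilde\nabla f,d\nu\rangle=\sum_{k=1}^{N_1}(X_kf)\,\langle X_k,d\nu\rangle,$$ where $\langle X,d\nu\rangle=d\nu(X,\cdot,\dots,\cdot)$ is the $(N-1)$-form obtained by contracting the volume form with the vector field $X$; the integral of a function over $\Omega$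 against $d\nu$ is the Lebesgue integral. Let $\Omega\subset\mathbb G$ be an admissible domain, that is, a bounded open set whose boundary is piecewise smooth and has no self-intersections, with $\Omega$ on one side of it. Precisely: $\partial\Omega=\bigcup_{i=1}^m\varphi_i(K_i)$, where each $K_i\subset\mathbb R^{N-1}$ is compact with $\partial K_i$ of Lebesgue measure zero, and $\varphi_i$ is a $C^1$ map into $\mathbb R^N$ on a neighbourhood of $K_i$; for every $t$ in the interior of $K_i$ the differential $D\varphi_i(t)$ is injective, $\varphi_i(t)=\varphi_j(s)$ with $s\in K_j$ holds only for $(j,s)=(i,t)$, and every vector $w$ for which $(w,\partial_1\varphi_i(t),\dots,\partial_{N-1}\varphi_i(t))$ is a positively oriented basis of $\mathbb R^N$ satisfies $\varphi_i(t)+sw\notin\overline\Omega$ and $\varphi_i(t)-sw\in\Omega$ for all sufficiently small $s>0$ (the orientation of $\partial\Omega$ induced by $\Omega$). The integral of an $(N-1)$-form $\eta$ over $\partial\Omega$ is $\int_{\partial\Omega}\eta=\sum_{i=1}^m\int_{K_i}\varphi_i^*\eta$. Let $u,v\in C^2(\Omega)\cap C^1(\overline\Omega)$ be real- or complex-valued,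 where $f\in C^1(\overline\Omega)$ means that $f\in C^1(\Omega)$ and that $f$ and its first-order derivatives in $\Omega$ extend continuously to $\overline\Omega$ (the extensions being used on $\partial\Omega$). Assume that $u\mathcal Lv-v\mathcal Lu$ is Lebesgue integrable on $\Omega$, so that the left-hand side below is defined. Then $$\int_\Omega(u\mathcal Lv-v\mathcal Lu)\,d\nu=\int_{\partial\Omega}\bigl(u\langle\widetilde\nabla v,d\nu\rangle-v\langle\widetilde\nabla u,d\nu\rangle\bigr).$$ -/

import Mathlib

open MeasureTheory Set
open scoped Manifold ContDiff

noncomputable section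

namespace Carnot

/-- The underlying manifold `ℝ^N`. -/
abbrev Pt (N : ℕ) := EuclideanSpace ℝ (Fin N)

/-! ### Homogeneous Carnot groups -/

/-- The dilation `δ_l`. The decomposition `ℝ^N = ℝ^{N₁} × ⋯ × ℝ^{N_r}` is recorded by the function
`σ`, where `σ i = k` means that the coordinate `x_i` belongs to the block `ℝ^{N_k}`. -/
def dilation {N : ℕ} (σ : Fin N → ℕ) (l : ℝ) (x : Pt N) : Pt N :=
  WithLp.toLp 2 fun i => l ^ σ i * x i

/-- The homogeneous dimension `Q = ∑ k N_k`. -/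
def homogeneousDimension {N : ℕ} (σ : Fin N → ℕ) : ℕ := ∑ i, σ i

/-- The left-invariant vector field that equals `∂/∂x_k` at the identity element: its value at `x`
is the image of `∂/∂x_k` under the differential at the identity of the left translation
`y ↦ x * y`. -/
def leftField {N : ℕ} [Group (Pt N)] (k : Fin N) (x : Pt N) : Pt N :=
  fderiv ℝ (fun y : Pt N => x * y) 1 (EuclideanSpace.single k (1 : ℝ))

/-- The iterated commutators of the generators `X_k`, `σ k = 1`. -/
inductive IsIteratedCommutator {N : ℕ} [Group (Pt N)] (σ : Fin N → ℕ) : (Pt N → Pt N) → Prop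
  | generator (k : Fin N) (hk : σ k = 1) : IsIteratedCommutator σ (leftField k)
  | bracket (V W : Pt N → Pt N) (hV : IsIteratedCommutator σ V) (hW : IsIteratedCommutator σ W) :
      IsIteratedCommutator σ (VectorField.lieBracket ℝ V W)

/-- The Lie group `(ℝ^N, *)` with the block decomposition `σ` is a homogeneous Carnot group.
(The identity element is then the origin, because it is fixed by all dilations.) -/
structure IsHomogeneousCarnotGroup {N : ℕ} [Group (Pt N)] [LieGroup 𝓘(ℝ, Pt N) ∞ (Pt N)]
    (σ : Fin N → ℕ) : Prop where
  one_le : ∀ i, 1 ≤ σ i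
  monotone : Monotone σ
  dilation_mul : ∀ l : ℝ, 0 < l → ∀ x y : Pt N,
    dilation σ l (x * y) = dilation σ l x * dilation σ l y
  rank_eq : ∀ x : Pt N,
    Submodule.span ℝ {w : Pt N | ∃ V, IsIteratedCommutator σ V ∧ w = V x} = ⊤

/-- The derivative `X_k f` of a real or complex function. -/
def fieldDeriv {N : ℕ} [Group (Pt N)] {𝕜 : Type*} [RCLike 𝕜] (k : Fin N) (f : Pt N → 𝕜)
    (x : Pt N) : 𝕜 :=
  fderiv ℝ f x (leftField k x)

/-- The sub-Laplacian `𝓛 f = ∑ X_k (X_k f)`, the sum being over the first block. -/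
def subLaplacian {N : ℕ} [Group (Pt N)] {𝕜 : Type*} [RCLike 𝕜] (σ : Fin N → ℕ) (f : Pt N → 𝕜)
    (x : Pt N) : 𝕜 :=
  ∑ k with σ k = 1, fieldDeriv k (fieldDeriv k f) x

/-! ### Functions of class `C¹` up to the boundary -/

/-- `f ∈ C¹(closure Ω)`: `f` is `C¹` in the open set `Ω`, and `f` and its first derivatives are
continuous up to the boundary. -/
structure IsC1UpToBoundary {N : ℕ} {𝕜 : Type*} [RCLike 𝕜] (Ω : Set (Pt N)) (f : Pt N → 𝕜) :
    Prop where
  contDiffOn : ContDiffOn ℝ 1 f Ω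
  continuousOn : ContinuousOn f (closure Ω)
  exists_extension : ∃ D : Pt N → Pt N →L[ℝ] 𝕜, ContinuousOn D (closure Ω) ∧ EqOn D (fderiv ℝ f) Ω

/-- The derivative of `f` on `closure Ω`, that is, the continuous extension to `closure Ω` of the
derivative of `f` in `Ω`. -/
def closureDeriv {N : ℕ} {𝕜 : Type*} [RCLike 𝕜] (Ω : Set (Pt N)) (f : Pt N → 𝕜) :
    Pt N → Pt N →L[ℝ] 𝕜 :=
  extendFrom Ω (fderiv ℝ f)

/-! ### Differential forms of degree `N - 1`, where `N = n + 1` -/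

/-- The volume form `dν = dx_1 ∧ ⋯ ∧ dx_N`. -/
def volForm (N : ℕ) : Pt N [⋀^Fin N]→ₗ[ℝ] ℝ :=
  (EuclideanSpace.basisFun (Fin N) ℝ).toBasis.det

/-- The pairing `⟨X, dν⟩` at a point where the vector field `X` has the value `w`: the contraction
of the volume form by `w`, that is, `(v_1, …, v_n) ↦ dν(w, v_1, …, v_n)`. -/
def contraction {n : ℕ} (w : Pt (n + 1)) : Pt (n + 1) [⋀^Fin n]→ₗ[ℝ] ℝ :=
  (volForm (n + 1)).curryLeft w

/-- The form `⟨∇̃ f, dν⟩ = ∑ (X_k f) ⟨X_k, dν⟩` on `closure Ω`, where `∇̃ f = ∑ (X_k f) X_k` and the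
sums are over the first block. It is real or complex valued, like `f`. -/
def gradForm {n : ℕ} [Group (Pt (n + 1))] {𝕜 : Type*} [RCLike 𝕜] (σ : Fin (n + 1) → ℕ)
    (Ω : Set (Pt (n + 1))) (f : Pt (n + 1) → 𝕜) (x : Pt (n + 1)) :
    Pt (n + 1) [⋀^Fin n]→ₗ[ℝ] 𝕜 :=
  ∑ k with σ k = 1,
    (LinearMap.toSpanSingleton ℝ 𝕜 (closureDeriv Ω f x (leftField k x))).compAlternatingMap
      (contraction (leftField k x))

/-! ### Piecewise smooth boundaries -/

/-- The vectors `∂φ/∂t_1, …, ∂φ/∂t_n` at `t`. -/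
def tangentFrame {n : ℕ} (φ : Pt n → Pt (n + 1)) (t : Pt n) : Fin n → Pt (n + 1) :=
  fun j => fderiv ℝ φ t (EuclideanSpace.single j (1 : ℝ))

/-- A presentation of the boundary of `Ω` as a piecewise smooth hypersurface without
self-intersections, with the orientation induced by `Ω`. The boundary is the union of finitely many
pieces; each of them is the image of a compact set `K i ⊆ ℝ^n` with negligible boundary
(a cube or a simplex, say) under a map `φ i` that is `C¹` near `K i`. On the interior of `K i` the
map `φ i` is an immersion, the points of the boundary that it parametrizes are attained only once
among all pieces, and a vector `w` such that `(w, ∂φ/∂t_1, …, ∂φ/∂t_n)` is a positive basis points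
out of `Ω`, while `-w` points into `Ω`. -/
structure PiecewiseSmoothBoundary {n : ℕ} (Ω : Set (Pt (n + 1))) where
  m : ℕ
  K : Fin m → Set (Pt n)
  φ : Fin m → Pt n → Pt (n + 1)
  frontier_eq : frontier Ω = ⋃ i, φ i '' K i
  isCompact : ∀ i, IsCompact (K i)
  null_frontier : ∀ i, volume (frontier (K i)) = 0
  contDiff : ∀ i, ∃ U, IsOpen U ∧ K i ⊆ U ∧ ContDiffOn ℝ 1 (φ i) U
  immersion : ∀ i, ∀ t ∈ interior (K i), Function.Injective (fderiv ℝ (φ i) t)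
  simple : ∀ i j, ∀ t ∈ interior (K i), ∀ s ∈ K j, φ i t = φ j s → i = j ∧ t = s
  oriented : ∀ i, ∀ t ∈ interior (K i), ∀ w : Pt (n + 1),
    0 < contraction w (tangentFrame (φ i) t) →
      ∃ ε > 0, ∀ s : ℝ, 0 < s → s < ε → φ i t + s • w ∉ closure Ω ∧ φ i t - s • w ∈ Ω

/-- The integral over `∂Ω` of a differential form `η` of degree `n`: the sum over the pieces of the
integrals of the pullbacks `φ_i^* η`. -/
def PiecewiseSmoothBoundary.integral {n : ℕ} {𝕜 : Type*} [RCLike 𝕜] {Ω : Set (Pt (n + 1))}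
    (S : PiecewiseSmoothBoundary Ω) (η : Pt (n + 1) → Pt (n + 1) [⋀^Fin n]→ₗ[ℝ] 𝕜) : 𝕜 :=
  ∑ i, ∫ t in S.K i, η (S.φ i t) (tangentFrame (S.φ i) t)

end Carnot

end

open Filter Topology

/-! Let ℓ be a real linear functional on the scalars and F = ∑ ℓ(u X_k v - v X_k u) X_k, the sum
over the first block. The generators X_k have zero Euclidean divergence: the ∂/∂x_j coefficient of
X_k is homogeneous of degree σ_j - 1 under dilations, so its x_j-derivative has degree -1 and, being
continuous at the origin, vanishes. Hence div F = ∑ X_k(ℓ(u X_k v - v X_k u)), the terms (X_k u)(X_k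
v) cancel, and div F = ℓ(u 𝓛v - v 𝓛u). The boundary form composed with ℓ is the contraction of the
volume form with F, so Green's formula is the divergence theorem for F; real and imaginary parts
serve as ℓ.

F is only continuous on the closure and C¹ inside, with integrable divergence. The divergence
theorem (`setIntegral_euclideanDiv_eq`) is therefore proved in two stages.

For a field g e_j of class C¹ on the whole space, `setIntegral_fderiv_single_eq_sum` slices Ω by
lines in the direction j. Almost every line meets the boundary only at regular points, finitely
many, and crosses it at each of them in the direction given by the sign of the j-th cofactor of the
chart. The fundamental theorem of calculus on the slice gives a signed sum over a fibre of the
projected charts, and the area formula with multiplicity turns the integral of these sums into the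
boundary integral.

For the general F, take a smooth G uniformly close to F on the closure. The charts may be taken
Lipschitz, so the boundary has finite Minkowski content. Integrating by parts against a cutoff at
distance δ from the complement then bounds the integral of div (F - G) by a constant times sup ‖F -
G‖ (`abs_integral_euclideanDiv_le`): the cutoff has slope at most 1/δ and varies only in a layer of
volume O(δ). No control of the derivatives of F near the boundary is needed. -/

/-! ### The fundamental theorem of calculus on open subsets of the line -/

/-- A preconnected set that meets `A` but not its frontier is contained in `A`. -/
theorem IsPreconnected.subset_of_disjoint_frontier {X : Type*} [TopologicalSpace X] {s A : Set X}
    (hs : IsPreconnected s) (hne : (s ∩ A).Nonempty) (hd : Disjoint s (frontier A)) : s ⊆ A := by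
  by_contra hsub
  obtain ⟨x, hx, hxA⟩ := not_subset.1 hsub
  obtain ⟨z, hz, hzi, hze⟩ := hs (interior A) (interior Aᶜ) isOpen_interior isOpen_interior
    (fun y hy => by
      by_contra h
      rw [mem_union, not_or, interior_compl, mem_compl_iff, not_not] at h
      exact disjoint_left.1 hd hy ⟨h.2, h.1⟩)
    (by
      obtain ⟨y, hy, hyA⟩ := hne
      refine ⟨y, hy, ?_⟩
      by_contra h
      exact disjoint_left.1 hd hy ⟨subset_closure hyA, h⟩)
    ⟨x, hx, by
      by_contra h
      rw [interior_compl, mem_compl_iff, not_not] at h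
      exact disjoint_left.1 hd hx ⟨h, fun h' => hxA (interior_subset h')⟩⟩
  exact interior_subset hze (interior_subset hzi)

/-- The set `A` lies immediately to the left of `p` if `e = 1`, and immediately to the right
of `p` if `e = -1`, and on that side only. -/
def IsCrossing (A : Set ℝ) (e p : ℝ) : Prop :=
  (e = 1 ∧ (∀ᶠ s in 𝓝[<] p, s ∈ A) ∧ ∀ᶠ s in 𝓝[>] p, s ∉ A) ∨
    (e = -1 ∧ (∀ᶠ s in 𝓝[<] p, s ∉ A) ∧ ∀ᶠ s in 𝓝[>] p, s ∈ A)

theorem IsCrossing.congr {A B : Set ℝ} {e p : ℝ} (h : IsCrossing A e p)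
    (hAB : ∀ᶠ s in 𝓝 p, s ∈ A ↔ s ∈ B) : IsCrossing B e p := by
  have hl : ∀ᶠ s in 𝓝[<] p, s ∈ A ↔ s ∈ B := nhdsWithin_le_nhds hAB
  have hr : ∀ᶠ s in 𝓝[>] p, s ∈ A ↔ s ∈ B := nhdsWithin_le_nhds hAB
  refine h.imp (fun h => ⟨h.1, ?_, ?_⟩) (fun h => ⟨h.1, ?_, ?_⟩)
  · filter_upwards [h.2.1, hl] with s h1 h2 using h2.1 h1
  · filter_upwards [h.2.2, hr] with s h1 h2 using mt h2.2 h1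
  · filter_upwards [h.2.1, hl] with s h1 h2 using mt h2.2 h1
  · filter_upwards [h.2.2, hr] with s h1 h2 using h2.1 h1

theorem IsCrossing.notMem {A : Set ℝ} {e p : ℝ} (h : IsCrossing A e p) (hA : IsOpen A) :
    p ∉ A := by
  intro hp
  have hp' : ∀ᶠ s in 𝓝 p, s ∈ A := hA.mem_nhds hp
  rcases h with ⟨-, -, h⟩ | ⟨-, h, -⟩
  · obtain ⟨s, h1, h2⟩ := (h.and (nhdsWithin_le_nhds hp')).exists
    exact h1 h2
  · obtain ⟨s, h1, h2⟩ := (h.and (nhdsWithin_le_nhds hp')).exists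
    exact h1 h2

/-- The fundamental theorem of calculus on a bounded open set of reals with finite frontier, all
of whose frontier points are crossings. -/
theorem setIntegral_deriv_eq_sum_of_isCrossing {f : ℝ → ℝ} (hf : ContDiff ℝ 1 f) (e : ℝ → ℝ)
    (P : Finset ℝ) : ∀ {A : Set ℝ}, IsOpen A → Bornology.IsBounded A → frontier A ⊆ P →
      (∀ p ∈ P, IsCrossing A (e p) p) → ∫ s in A, deriv f s = ∑ p ∈ P, e p * f p := by
  -- The two largest points `q < p` are the ends of a component `Ioo q p` of `A`: boundedness forces
  -- sign `1` at `p` and the existence of `q`, and then the sign at `q` must be `-1`. This component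
  -- is split off and the induction continues with `A ∩ Iio q`.
  induction hc : P.card using Nat.strong_induction_on generalizing P with
  | _ c ih =>
  intro A hA hb hfr hcr
  obtain ⟨a, b, hab⟩ : ∃ a b : ℝ, A ⊆ Icc a b := by
    obtain ⟨a, ha⟩ := hb.bddBelow
    obtain ⟨b, hb⟩ := hb.bddAbove
    exact ⟨a, b, fun x hx => ⟨ha hx, hb hx⟩⟩
  rcases P.eq_empty_or_nonempty with rfl | hP
  · have : frontier A = ∅ := by simpa using hfr
    rcases frontier_eq_empty_iff.1 this with h | h
    · simp [h]
    · have := hab (h ▸ mem_univ (b + 1)); simp at this; linarith [this.2]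
  set p := P.max' hP with hpdef
  have hpP : p ∈ P := P.max'_mem hP
  have hIoi : Disjoint (Ioi p) (frontier A) := disjoint_left.2 fun x hx hxA =>
    absurd (P.le_max' x (hfr hxA)) (not_le.2 hx)
  rcases hcr p hpP with ⟨hep, hpl, hpr⟩ | ⟨hep, hpl, hpr⟩
  swap
  · exfalso
    obtain ⟨s, hs, hs'⟩ := (hpr.and self_mem_nhdsWithin).exists
    have := isPreconnected_Ioi.subset_of_disjoint_frontier ⟨s, hs', hs⟩ hIoi
    have h1 : max p b + 1 ∈ Ioi p := by simp only [mem_Ioi]; linarith [le_max_left p b]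
    linarith [(hab (this h1)).2, le_max_right p b]
  have hP' : (P.erase p).Nonempty := by
    by_contra h
    rw [Finset.not_nonempty_iff_eq_empty] at h
    obtain ⟨s, hs, hs'⟩ := (hpl.and self_mem_nhdsWithin).exists
    have hd : Disjoint (Iio p) (frontier A) := disjoint_left.2 fun x hx hxA => by
      have : x ∈ P.erase p := Finset.mem_erase.2 ⟨hx.ne, hfr hxA⟩
      simp [h] at this
    have := isPreconnected_Iio.subset_of_disjoint_frontier ⟨s, hs', hs⟩ hd
    have h1 : min p a - 1 ∈ Iio p := by simp only [mem_Iio]; linarith [min_le_left p a]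
    linarith [(hab (this h1)).1, min_le_right p a]
  set q := (P.erase p).max' hP' with hqdef
  have hqP' : q ∈ P.erase p := (P.erase p).max'_mem hP'
  obtain ⟨hqp, hqP⟩ := Finset.mem_erase.1 hqP'
  have hlt : q < p := lt_of_le_of_ne (P.le_max' q hqP) hqp
  have hbetween : ∀ x ∈ P, x ≤ q ∨ x = p := fun x hx => by
    by_cases h : x = p
    · exact Or.inr h
    · exact Or.inl ((P.erase p).le_max' x (Finset.mem_erase.2 ⟨h, hx⟩))
  have hIoo : Ioo q p ⊆ A := by
    obtain ⟨s, hs, hs'⟩ := (hpl.and (Ioo_mem_nhdsLT hlt)).exists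
    refine isPreconnected_Ioo.subset_of_disjoint_frontier ⟨s, hs', hs⟩ (disjoint_left.2 ?_)
    intro x hx hxA
    rcases hbetween x (hfr hxA) with h | h
    · exact absurd hx.1 (not_lt.2 h)
    · exact absurd hx.2 (by simp [h])
  rcases hcr q hqP with ⟨heq, hql, hqr⟩ | ⟨heq, hql, hqr⟩
  · exfalso
    obtain ⟨s, hs, hs'⟩ := (hqr.and (Ioo_mem_nhdsGT hlt)).exists
    exact hs (hIoo hs')
  have hqA : q ∉ A := (hcr q hqP).notMem hA
  have hpA : p ∉ A := (hcr p hpP).notMem hA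
  have hAp : ∀ x ∈ A, x < p := by
    intro x hx
    by_contra! h
    rcases h.eq_or_lt with h | h
    · exact hpA (h ▸ hx)
    · have := isPreconnected_Ioi.subset_of_disjoint_frontier ⟨x, h, hx⟩ hIoi
      obtain ⟨s, hs, hs'⟩ := (hpr.and self_mem_nhdsWithin).exists
      exact hs (this hs')
  have hdecomp : A = A ∩ Iio q ∪ Ioo q p := by
    ext x
    constructor
    · intro hx
      rcases lt_trichotomy x q with h | h | h
      · exact Or.inl ⟨hx, h⟩
      · exact absurd (h ▸ hx) hqA
      · exact Or.inr ⟨h, hAp x hx⟩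
    · rintro (h | h)
      · exact h.1
      · exact hIoo h
  -- Since `A` is absent just to the left of `q`, cutting at `q` leaves no frontier point there.
  have hqcl : q ∉ closure (A ∩ Iio q) := by
    rw [mem_closure_iff_frequently, not_frequently]
    rw [eventually_nhdsWithin_iff] at hql
    filter_upwards [hql] with s hs h using hs h.2 h.1
  have hfr' : frontier (A ∩ Iio q) ⊆ (P.erase p).erase q := by
    intro x hx
    have hxcl : x ∈ closure (A ∩ Iio q) := hx.1
    have hxq : x ≠ q := fun h => hqcl (h ▸ hxcl)
    have hxle : x ≤ q := by
      have := closure_mono (inter_subset_right (s := A)) hxcl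
      rwa [closure_Iio] at this
    have hxP : x ∈ P := by
      rcases frontier_inter_subset A (Iio q) hx with h | h
      · exact hfr h.1
      · have := h.2
        rw [frontier_Iio] at this
        exact absurd this hxq
    simp only [Finset.coe_erase, Set.mem_sdiff, mem_singleton_iff, Finset.mem_coe]
    exact ⟨⟨hxP, fun h => by linarith [h ▸ hxle]⟩, hxq⟩
  have hcr' : ∀ x ∈ (P.erase p).erase q, IsCrossing (A ∩ Iio q) (e x) x := by
    intro x hx
    obtain ⟨hxq, hx⟩ := Finset.mem_erase.1 hx
    obtain ⟨hxp, hxP⟩ := Finset.mem_erase.1 hx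
    have hlt : x < q := lt_of_le_of_ne ((hbetween x hxP).resolve_right hxp) hxq
    refine (hcr x hxP).congr ?_
    filter_upwards [Iio_mem_nhds hlt] with s hs
    exact ⟨fun h => ⟨h, hs⟩, fun h => h.1⟩
  have hcard : ((P.erase p).erase q).card < c := by
    rw [← hc]
    exact (Finset.card_lt_card (Finset.erase_ssubset hqP')).trans
      (Finset.card_lt_card (Finset.erase_ssubset hpP))
  have hIH := ih _ hcard _ rfl (hA.inter isOpen_Iio) (hb.subset inter_subset_left) hfr' hcr'
  have hcont : Continuous (deriv f) := hf.continuous_deriv le_rfl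
  have hint : ∀ s ⊆ Icc a b ∪ Icc q p, IntegrableOn (deriv f) s := fun s hs =>
    ((hcont.continuousOn.integrableOn_compact
      (isCompact_Icc.union isCompact_Icc))).mono_set hs
  rw [hdecomp, setIntegral_union _ measurableSet_Ioo, hIH,
    ← Finset.add_sum_erase P _ hpP, ← Finset.add_sum_erase _ _ hqP', heq, hep,
    ← integral_Ioc_eq_integral_Ioo, ← intervalIntegral.integral_of_le hlt.le,
    intervalIntegral.integral_deriv_eq_sub]
  · ring
  · intro x _
    exact hf.differentiable one_ne_zero x
  · exact hcont.intervalIntegrable _ _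
  · exact hint _ (inter_subset_left.trans (hab.trans subset_union_left))
  · exact hint _ (Ioo_subset_Icc_self.trans subset_union_right)
  · exact disjoint_left.2 fun x h1 h2 => lt_asymm h1.2 h2.1

/-! ### Global extension of C¹ maps given near a compact set -/

namespace Carnot

/-- A map that is `C¹` near a compact set agrees near that set with a compactly supported
`C¹` map on the whole space. -/
theorem exists_contDiff_hasCompactSupport_eventuallyEq {E F : Type*} [NormedAddCommGroup E]
    [NormedSpace ℝ E] [FiniteDimensional ℝ E] [NormedAddCommGroup F] [NormedSpace ℝ F]
    {f : E → F} {K U : Set E} (hK : IsCompact K) (hU : IsOpen U) (hKU : K ⊆ U)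
    (hf : ContDiffOn ℝ 1 f U) :
    ∃ g : E → F, ContDiff ℝ 1 g ∧ HasCompactSupport g ∧ tsupport g ⊆ U ∧
      ∀ x ∈ K, g =ᶠ[𝓝 x] f := by
  obtain ⟨L, hL, hKL, hLU⟩ := exists_compact_between hK hU hKU
  obtain ⟨θ, hθ1, hθ0, -⟩ := exists_contMDiffMap_one_nhds_of_subset_interior 𝓘(ℝ, E) (n := 1)
    hK.isClosed hKL
  have hθ : ContDiff ℝ 1 θ := θ.contMDiff.contDiff
  have hsupp : Function.support (fun x => θ x • f x) ⊆ L := fun x hx => by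
    by_contra h
    exact hx (by simp [hθ0 x h])
  have hts : tsupport (fun x => θ x • f x) ⊆ L := closure_minimal hsupp hL.isClosed
  refine ⟨fun x => θ x • f x, ?_, HasCompactSupport.of_support_subset_isCompact hL hsupp,
    hts.trans hLU, fun x hx => ?_⟩
  · refine contMDiff_iff_contDiff.1 (contMDiff_of_tsupport fun x hx => ?_)
    exact (hθ.contDiffAt.smul (hf.contDiffAt (hU.mem_nhds (hLU (hts hx))))).contMDiffAt
  · filter_upwards [hθ1.filter_mono (nhds_le_nhdsSet hx)] with y hy
    simp [hy]

end Carnot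

/-! ### The area formula with multiplicity -/

/-- A measurable set on which a map has invertible derivatives splits into countably many
measurable pieces on which the map is injective. -/
theorem exists_countable_partition_injOn {E : Type*} [NormedAddCommGroup E] [NormedSpace ℝ E]
    [FiniteDimensional ℝ E] [MeasurableSpace E] [BorelSpace E] {f : E → E} {s : Set E}
    {f' : E → E →L[ℝ] E} (hf' : ∀ x ∈ s, HasFDerivWithinAt f (f' x) s x)
    (hdet : ∀ x ∈ s, (f' x).det ≠ 0) :
    ∃ t : ℕ → Set E, Pairwise (Function.onFun Disjoint t) ∧ (∀ k, MeasurableSet (t k)) ∧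
      s ⊆ ⋃ k, t k ∧ ∀ k, InjOn f (s ∩ t k) := by
  classical
  have key : ∀ A : E →L[ℝ] E, ∃ r : NNReal, r ≠ 0 ∧ (A.det ≠ 0 → ∀ t : Set E,
      ApproximatesLinearOn f A t r → InjOn f t) := by
    intro A
    by_cases hA : A.det = 0
    · exact ⟨1, one_ne_zero, fun h => absurd hA h⟩
    let B := A.toContinuousLinearEquivOfDetNeZero hA
    rcases subsingleton_or_nontrivial E with hE | hE
    · exact ⟨1, one_ne_zero, fun _ t _ => (Set.subsingleton_of_subsingleton).injOn f⟩
    · have hpos : 0 < ‖(B.symm : E →L[ℝ] E)‖₊⁻¹ := by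
        rw [inv_pos]
        exact B.nnnorm_symm_pos
      refine ⟨‖(B.symm : E →L[ℝ] E)‖₊⁻¹ / 2, (half_pos hpos).ne', fun _ t ht => ?_⟩
      have ht' : ApproximatesLinearOn f (B : E →L[ℝ] E) t (‖(B.symm : E →L[ℝ] E)‖₊⁻¹ / 2) := by
        have : (B : E →L[ℝ] E) = A := by ext x; rfl
        rwa [this]
      exact ht'.injOn (Or.inr (half_lt_self hpos))
  choose r hr0 hr using key
  obtain ⟨t, A, h1, h2, h3, h4, h5⟩ :=
    exists_partition_approximatesLinearOn_of_hasFDerivWithinAt f s f' hf' r hr0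
  refine ⟨t, h1, h2, h3, fun k => ?_⟩
  rcases s.eq_empty_or_nonempty with rfl | hs
  · simp
  · obtain ⟨y, hy, hA⟩ := h5 hs k
    exact hr _ (hA ▸ hdet y hy) _ (h4 k)

/-- The area formula with multiplicity, for a map between spaces of the same dimension. -/
theorem setIntegral_abs_det_smul_eq_integral_finsum {E F : Type*} [NormedAddCommGroup E]
    [NormedSpace ℝ E] [FiniteDimensional ℝ E] [MeasurableSpace E] [BorelSpace E]
    (μ : Measure E) [μ.IsAddHaarMeasure] [NormedAddCommGroup F] [NormedSpace ℝ F] {f : E → E}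
    {s : Set E} {f' : E → E →L[ℝ] E} (hs : MeasurableSet s)
    (hf' : ∀ x ∈ s, HasFDerivWithinAt f (f' x) s x) (hdet : ∀ x ∈ s, (f' x).det ≠ 0)
    {h : E → F} (hint : IntegrableOn (fun x => |(f' x).det| • h x) s μ)
    (hfin : ∀ᵐ y ∂μ, (s ∩ f ⁻¹' {y}).Finite) :
    Integrable (fun y => ∑ᶠ x ∈ s ∩ f ⁻¹' {y}, h x) μ ∧
      ∫ x in s, |(f' x).det| • h x ∂μ = ∫ y, ∑ᶠ x ∈ s ∩ f ⁻¹' {y}, h x ∂μ := by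
  classical
  obtain ⟨t, htd, htm, hst, hinj⟩ := exists_countable_partition_injOn hf' hdet
  have hsU : s = ⋃ k, s ∩ t k := by rw [← inter_iUnion, inter_eq_left.2 hst]
  have hWm : ∀ k, MeasurableSet (s ∩ t k) := fun k => hs.inter (htm k)
  have hWd : Pairwise (Function.onFun Disjoint fun k => s ∩ t k) := fun i j hij =>
    (htd hij).mono inter_subset_right inter_subset_right
  have hWf : ∀ k, ∀ x ∈ s ∩ t k, HasFDerivWithinAt f (f' x) (s ∩ t k) x := fun k x hx =>
    (hf' x hx.1).mono inter_subset_left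
  let inv : ℕ → E → E := fun k => Function.invFunOn f (s ∩ t k)
  have hinv : ∀ k, ∀ x ∈ s ∩ t k, inv k (f x) = x := fun k x hx =>
    (hinj k).leftInvOn_invFunOn hx
  -- `g k` is `h` transported by the inverse of `f` on the `k`-th piece and extended by zero; summed
  -- over `k` it gives the fibre sum wherever the fibre is finite.
  let g : ℕ → E → F := fun k => (f '' (s ∩ t k)).indicator fun y => h (inv k y)
  have him : ∀ k, MeasurableSet (f '' (s ∩ t k)) := fun k =>
    measurable_image_of_fderivWithin (hWm k) (hWf k) (hinj k)
  have hgi : ∀ k, Integrable (g k) μ := by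
    intro k
    rw [integrable_indicator_iff (him k),
      integrableOn_image_iff_integrableOn_abs_det_fderiv_smul μ (hWm k) (hWf k) (hinj k)]
    refine (hint.mono_set inter_subset_left).congr_fun (fun x hx => ?_) (hWm k)
    simp only [hinv k x hx]
  have hgI : ∀ k, ∫ y, g k y ∂μ = ∫ x in s ∩ t k, |(f' x).det| • h x ∂μ := by
    intro k
    rw [integral_indicator (him k),
      integral_image_eq_integral_abs_det_fderiv_smul μ (hWm k) (hWf k) (hinj k)]
    refine setIntegral_congr_fun (hWm k) fun x hx => ?_
    simp only [hinv k x hx]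
  have hgL : ∀ k, ∫⁻ y, ‖g k y‖ₑ ∂μ = ∫⁻ x in s ∩ t k, ‖|(f' x).det| • h x‖ₑ ∂μ := by
    intro k
    simp only [g, enorm_indicator_eq_indicator_enorm]
    rw [lintegral_indicator (him k),
      lintegral_image_eq_lintegral_abs_det_fderiv_mul μ (hWm k) (hWf k) (hinj k)]
    refine setLIntegral_congr_fun (hWm k) fun x hx => ?_
    simp only [hinv k x hx]
    rw [enorm_smul, Real.enorm_eq_ofReal (abs_nonneg _)]
  have hsum : ∑' k, ∫⁻ y, ‖g k y‖ₑ ∂μ ≠ ⊤ := by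
    simp only [hgL]
    rw [← lintegral_iUnion hWm hWd, ← hsU]
    exact hint.2.ne
  have hae : ∀ᵐ y ∂μ, HasSum (fun k => g k y) (∑ᶠ x ∈ s ∩ f ⁻¹' {y}, h x) := by
    filter_upwards [hfin] with y hy
    have hgk : ∀ k, g k y = ∑ x ∈ hy.toFinset, (t k).indicator h x := by
      intro k
      by_cases hyk : y ∈ f '' (s ∩ t k)
      · obtain ⟨x, hx, rfl⟩ := hyk
        rw [Finset.sum_eq_single x]
        · simp only [g]
          rw [indicator_of_mem (mem_image_of_mem f hx), hinv k x hx, indicator_of_mem hx.2]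
        · intro x' hx' hne
          refine indicator_of_notMem (fun hx't => hne ?_) _
          rw [Finite.mem_toFinset] at hx'
          exact hinj k ⟨hx'.1, hx't⟩ hx hx'.2
        · intro hx'
          exact absurd (hy.mem_toFinset.2 ⟨hx.1, rfl⟩) hx'
      · simp only [g]
        rw [indicator_of_notMem hyk, Finset.sum_eq_zero]
        intro x hx
        rw [Finite.mem_toFinset] at hx
        exact indicator_of_notMem (fun hxt => hyk ⟨x, ⟨hx.1, hxt⟩, hx.2⟩) _
    have hone : ∀ x ∈ hy.toFinset, HasSum (fun k => (t k).indicator h x) (h x) := by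
      intro x hx
      rw [Finite.mem_toFinset] at hx
      obtain ⟨k, hk⟩ := mem_iUnion.1 (hst hx.1)
      have := hasSum_single (f := fun k => (t k).indicator h x) k
        fun j hj => indicator_of_notMem (disjoint_right.1 (htd hj) hk) _
      rwa [indicator_of_mem hk] at this
    simp only [hgk]
    rw [finsum_mem_eq_finite_toFinset_sum _ hy]
    exact hasSum_sum hone
  refine ⟨⟨?_, ?_⟩, ?_⟩
  · exact aestronglyMeasurable_of_tendsto_ae atTop
      (fun a => Finset.aestronglyMeasurable_fun_sum a fun k _ => (hgi k).aestronglyMeasurable) hae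
  · refine lt_of_le_of_lt ?_ (lt_top_iff_ne_top.2 hsum)
    rw [← lintegral_tsum fun k => (hgi k).aestronglyMeasurable.enorm]
    refine lintegral_mono_ae ?_
    filter_upwards [hae] with y hy
    exact le_of_tendsto hy.enorm (Eventually.of_forall fun a =>
      (enorm_sum_le _ _).trans (ENNReal.sum_le_tsum a))
  · rw [integral_congr_ae (hae.mono fun y hy => hy.tsum_eq.symm),
      integral_tsum (fun k => (hgi k).aestronglyMeasurable) hsum]
    simp only [hgI]
    conv_lhs => rw [hsU]
    exact integral_iUnion hWm hWd (hsU ▸ hint)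

/-! ### Minkowski content of Lipschitz images -/

/-- The image of a compact set of dimension `n` under a Lipschitz map into a space of dimension
`n + 1` has finite Minkowski content. -/
theorem LipschitzWith.exists_measure_cthickening_image_le {E F : Type*} [NormedAddCommGroup E]
    [NormedSpace ℝ E] [FiniteDimensional ℝ E] [MeasurableSpace E] [BorelSpace E]
    [NormedAddCommGroup F] [NormedSpace ℝ F] [FiniteDimensional ℝ F] [MeasurableSpace F]
    [BorelSpace F] (μ : Measure E) [μ.IsAddHaarMeasure] (ν : Measure F) [ν.IsAddHaarMeasure]
    (hdim : Module.finrank ℝ F = Module.finrank ℝ E + 1) {f : E → F} {L : NNReal}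
    (hf : LipschitzWith L f) {K : Set E} (hK : IsCompact K) :
    ∃ C : NNReal, ∀ δ : ℝ, 0 < δ → δ ≤ 1 →
      ν (Metric.cthickening δ (f '' K)) ≤ C * ENNReal.ofReal δ := by
  set n := Module.finrank ℝ E
  set K₁ := Metric.cthickening 1 K
  have hK₁ : IsCompact K₁ := hK.cthickening
  set b := μ (Metric.ball 0 1)
  set c := ν (Metric.ball 0 1)
  have hb0 : b ≠ 0 := (Metric.measure_ball_pos μ 0 one_pos).ne'
  have hbt : b ≠ ⊤ := measure_ball_lt_top.ne
  have hct : c ≠ ⊤ := measure_ball_lt_top.ne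
  set D : ENNReal := μ K₁ * ENNReal.ofReal ((1 + L : ℝ) ^ (n + 1)) * c / b with hD
  have hDt : D ≠ ⊤ := ENNReal.div_ne_top
    (ENNReal.mul_ne_top (ENNReal.mul_ne_top hK₁.measure_lt_top.ne ENNReal.ofReal_ne_top) hct) hb0
  refine ⟨D.toNNReal, fun δ hδ hδ1 => ?_⟩
  rw [ENNReal.coe_toNNReal hDt]
  set T := Metric.cthickening δ (f '' K)
  -- The measure of `S` is estimated through both families of slices. A point of the thickening is
  -- related to a whole `δ`-ball of parameters, which stays in `K₁` because `δ ≤ 1`; a parameter is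
  -- related only to points in a ball of radius `(1 + L) * δ`. The quotient of δ^(n+1) by δ^n leaves
  -- one factor δ.
  let S : Set (F × E) := {z | z.2 ∈ K₁ ∧ dist z.1 (f z.2) ≤ (1 + L) * δ}
  have hSm : MeasurableSet S := by
    refine IsClosed.measurableSet (IsClosed.inter ?_ ?_)
    · exact hK₁.isClosed.preimage continuous_snd
    · exact isClosed_le (continuous_fst.dist (hf.continuous.comp continuous_snd)) continuous_const
  have hT : ∀ x ∈ T, ENNReal.ofReal (δ ^ n) * b ≤ μ (Prod.mk x ⁻¹' S) := by
    intro x hx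
    simp only [T, (hK.image hf.continuous).cthickening_eq_biUnion_closedBall hδ.le, mem_iUnion,
      exists_prop, exists_mem_image, Metric.mem_closedBall] at hx
    obtain ⟨t, ht, hxt⟩ := hx
    rw [← Measure.addHaar_closedBall μ t hδ.le]
    refine measure_mono fun s hs => ?_
    rw [Metric.mem_closedBall] at hs
    refine ⟨Metric.mem_cthickening_of_dist_le s t 1 K ht (hs.trans hδ1), ?_⟩
    calc dist x (f s) ≤ dist x (f t) + dist (f t) (f s) := dist_triangle _ _ _
      _ ≤ δ + L * dist t s := add_le_add hxt (hf.dist_le_mul t s)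
      _ ≤ δ + L * δ := by rw [dist_comm t s]; gcongr
      _ = (1 + L) * δ := by ring
  have hL : 0 ≤ (1 + L : ℝ) * δ := by positivity
  have h1 : ENNReal.ofReal (δ ^ n) * b * ν T ≤ (ν.prod μ) S := by
    rw [Measure.prod_apply hSm, ← setLIntegral_const]
    exact (setLIntegral_mono' Metric.isClosed_cthickening.measurableSet hT).trans
      (setLIntegral_le_lintegral _ _)
  have h2 : (ν.prod μ) S ≤ μ K₁ * (ENNReal.ofReal (((1 + L) * δ) ^ (n + 1)) * c) := by
    rw [Measure.prod_apply_symm hSm]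
    calc ∫⁻ y, ν ((fun x => (x, y)) ⁻¹' S) ∂μ
        ≤ ∫⁻ y, K₁.indicator (fun _ => ENNReal.ofReal (((1 + L) * δ) ^ (n + 1)) * c) y ∂μ := by
          refine lintegral_mono fun y => ?_
          by_cases hy : y ∈ K₁
          · rw [indicator_of_mem hy, ← hdim, ← Measure.addHaar_closedBall ν (f y) hL]
            exact measure_mono fun x hx => hx.2
          · rw [indicator_of_notMem hy, nonpos_iff_eq_zero]
            convert measure_empty (μ := ν)
            ext x
            simp [S, hy]
      _ = _ := by
          rw [lintegral_indicator hK₁.measurableSet, setLIntegral_const, mul_comm]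
  have ha0 : ENNReal.ofReal (δ ^ n) * b ≠ 0 :=
    mul_ne_zero (ENNReal.ofReal_pos.2 (by positivity)).ne' hb0
  have hat : ENNReal.ofReal (δ ^ n) * b ≠ ⊤ := ENNReal.mul_ne_top ENNReal.ofReal_ne_top hbt
  rw [← ENNReal.mul_le_mul_iff_right ha0 hat]
  refine (h1.trans h2).trans (le_of_eq ?_)
  have hDb : D * b = μ K₁ * ENNReal.ofReal ((1 + L : ℝ) ^ (n + 1)) * c :=
    ENNReal.div_mul_cancel hb0 hbt
  calc μ K₁ * (ENNReal.ofReal (((1 + L) * δ) ^ (n + 1)) * c)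
      = (D * b) * (ENNReal.ofReal (δ ^ n) * ENNReal.ofReal δ) := by
        rw [hDb, ← ENNReal.ofReal_mul (by positivity), mul_pow, pow_succ δ n,
          ENNReal.ofReal_mul (by positivity)]
        ring
    _ = _ := by ring

/-! ### Inner cutoffs and the bound on the integral of a divergence -/

namespace Carnot

/-- The Euclidean divergence of a vector field. -/
noncomputable def euclideanDiv {N : ℕ} (F : Pt N → Pt N) (x : Pt N) : ℝ :=
  ∑ j, fderiv ℝ (fun y => F y j) x (EuclideanSpace.single j 1)

/-- The cutoff function of an open set that vanishes up to the distance `δ` from the complement and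
equals `1` beyond the distance `2δ`. -/
noncomputable def innerCutoff {N : ℕ} (Ω : Set (Pt N)) (δ : ℝ) (x : Pt N) : ℝ :=
  max 0 (min 1 (δ⁻¹ * Metric.infDist x Ωᶜ - 1))

section innerCutoff

variable {N : ℕ} {Ω : Set (Pt N)} {δ : ℝ}

theorem innerCutoff_nonneg (x : Pt N) : 0 ≤ innerCutoff Ω δ x := le_max_left _ _

theorem innerCutoff_le_one (x : Pt N) : innerCutoff Ω δ x ≤ 1 :=
  max_le zero_le_one (min_le_left _ _)

theorem innerCutoff_eq_zero (hδ : 0 < δ) {x : Pt N} (hx : Metric.infDist x Ωᶜ ≤ δ) :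
    innerCutoff Ω δ x = 0 := by
  refine max_eq_left ((min_le_right _ _).trans ?_)
  rw [sub_nonpos, inv_mul_le_iff₀ hδ, mul_one]
  exact hx

theorem innerCutoff_eq_one (hδ : 0 < δ) {x : Pt N} (hx : 2 * δ ≤ Metric.infDist x Ωᶜ) :
    innerCutoff Ω δ x = 1 := by
  have : 1 ≤ δ⁻¹ * Metric.infDist x Ωᶜ - 1 := by
    rw [le_sub_iff_add_le, le_inv_mul_iff₀ hδ]
    linarith
  rw [innerCutoff, min_eq_left this, max_eq_right zero_le_one]

theorem lipschitzWith_innerCutoff (hδ : 0 < δ) :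
    LipschitzWith (Real.toNNReal δ⁻¹) (innerCutoff Ω δ) := by
  refine (LipschitzWith.const_min ?_ 1).const_max 0
  refine LipschitzWith.of_dist_le_mul fun x y => ?_
  have := (Metric.lipschitz_infDist_pt Ωᶜ).dist_le_mul x y
  rw [Real.coe_toNNReal _ (by positivity), Real.dist_eq, sub_sub_sub_cancel_right, ← mul_sub,
    abs_mul, abs_of_pos (inv_pos.2 hδ), ← Real.dist_eq]
  gcongr
  simpa using this

/-- A nearest point of the complement is a frontier point, because the open ball reaching up to it
lies in `Ω`. -/
theorem mem_cthickening_frontier (hΩ : IsOpen Ω) (hne : Ωᶜ.Nonempty) {x : Pt N} (hx : x ∈ Ω)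
    (hd : Metric.infDist x Ωᶜ ≤ δ) : x ∈ Metric.cthickening δ (frontier Ω) := by
  obtain ⟨y, hy, hxy⟩ := hΩ.isClosed_compl.exists_infDist_eq_dist hne x
  have hpos : 0 < dist x y := dist_pos.2 fun h => hy (h ▸ hx)
  have hball : Metric.ball x (dist x y) ⊆ Ω := by
    rw [← hxy]
    intro z hz
    by_contra h
    exact absurd (Metric.infDist_le_dist_of_mem (x := x) h)
      (not_le.2 (by rwa [Metric.mem_ball, dist_comm] at hz))
  have hycl : y ∈ closure Ω := by
    refine closure_mono hball ?_
    rw [closure_ball x hpos.ne', Metric.mem_closedBall, dist_comm]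
  refine Metric.mem_cthickening_of_dist_le x y δ _ ⟨hycl, ?_⟩ (hxy ▸ hd)
  rwa [hΩ.interior_eq]

/-- Integration by parts against the cutoff function of a set whose frontier has finite Minkowski
content. -/
theorem abs_integral_innerCutoff_mul_fderiv_le (hΩ : IsOpen Ω) (hbdd : Bornology.IsBounded Ω)
    (hne : Ωᶜ.Nonempty) {C : NNReal}
    (hC : ∀ δ : ℝ, 0 < δ → δ ≤ 1 →
      volume (Metric.cthickening δ (frontier Ω)) ≤ C * ENNReal.ofReal δ)
    {h : Pt N → ℝ} (hh : ContDiffOn ℝ 1 h Ω) {ε : ℝ} (hε : 0 ≤ ε) (hhε : ∀ x ∈ Ω, |h x| ≤ ε)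
    (hδ : 0 < δ) (hδ1 : 2 * δ ≤ 1) {v : Pt N} (hv : ‖v‖ = 1) :
    IntegrableOn (fun x => innerCutoff Ω δ x * fderiv ℝ h x v) Ω ∧
      |∫ x in Ω, innerCutoff Ω δ x * fderiv ℝ h x v| ≤ 2 * C * ε := by
  have hdcont : Continuous fun x : Pt N => Metric.infDist x Ωᶜ := Metric.continuous_infDist_pt _
  set K : Set (Pt N) := {x | δ ≤ Metric.infDist x Ωᶜ}
  have hKΩ : K ⊆ Ω := fun x hx => by
    by_contra hxΩ
    have h0 := Metric.infDist_zero_of_mem (s := Ωᶜ) hxΩ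
    simp only [K, mem_ofPred_eq, h0] at hx
    exact absurd hx (not_le.2 hδ)
  have hKc : IsCompact K :=
    Metric.isCompact_of_isClosed_isBounded (isClosed_le continuous_const hdcont) (hbdd.subset hKΩ)
  -- The cutoff vanishes off `K`, so `h` may be replaced by a compactly supported global `g` that
  -- agrees with it near `K`; integration by parts for Lipschitz functions then applies.
  obtain ⟨g, hg, hgs, hgΩ, hgh⟩ := exists_contDiff_hasCompactSupport_eventuallyEq hKc hΩ hKΩ hh
  obtain ⟨D, hD⟩ := ContDiff.lipschitzWith_of_hasCompactSupport hgs hg one_ne_zero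
  have hχ := lipschitzWith_innerCutoff (Ω := Ω) hδ
  have hχK : ∀ x ∉ K, innerCutoff Ω δ x = 0 := fun x hx => innerCutoff_eq_zero hδ (not_le.1 hx).le
  have hfd : ∀ x, innerCutoff Ω δ x * fderiv ℝ h x v = innerCutoff Ω δ x * fderiv ℝ g x v := by
    intro x
    by_cases hx : x ∈ K
    · rw [(hgh x hx).fderiv_eq]
    · rw [hχK x hx, zero_mul, zero_mul]
  have hcont : Continuous fun x => innerCutoff Ω δ x * fderiv ℝ g x v :=
    hχ.continuous.mul ((hg.continuous_fderiv one_ne_zero).clm_apply continuous_const)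
  have hint : Integrable fun x => innerCutoff Ω δ x * fderiv ℝ g x v :=
    hcont.integrable_of_hasCompactSupport ((hgs.fderiv_apply ℝ v).mul_left)
  simp only [hfd]
  refine ⟨hint.integrableOn, ?_⟩
  have hzero : ∀ x ∉ Ω, innerCutoff Ω δ x * fderiv ℝ g x v = 0 := fun x hx => by
    rw [hχK x (fun h => hx (hKΩ h)), zero_mul]
  rw [setIntegral_eq_integral_of_forall_compl_eq_zero hzero]
  have hparts := hχ.integral_lineDeriv_mul_eq (μ := volume) hD hgs v
  have hneg : ∀ x, lineDeriv ℝ g x (-v) * innerCutoff Ω δ x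
      = -(innerCutoff Ω δ x * fderiv ℝ g x v) := by
    intro x
    rw [(hg.differentiable one_ne_zero x).lineDeriv_eq_fderiv, map_neg]
    ring
  simp only [hneg] at hparts
  rw [integral_neg] at hparts
  rw [← abs_neg, ← hparts]
  set T := Metric.cthickening (2 * δ) (frontier Ω)
  have hTc : IsCompact T :=
    (Metric.isCompact_of_isClosed_isBounded isClosed_frontier
      (hbdd.closure.subset frontier_subset_closure)).cthickening
  -- The cutoff is locally constant at distances below `δ` and above `2 * δ`. In between its slope
  -- is at most `δ⁻¹`, which is compensated by the volume `C * (2 * δ)` of `T`.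
  have hbound : ∀ x, ‖lineDeriv ℝ (innerCutoff Ω δ) x v * g x‖ ≤
      T.indicator (fun _ => δ⁻¹ * ε) x := by
    intro x
    have hnn : 0 ≤ T.indicator (fun _ => δ⁻¹ * ε) x := indicator_nonneg (fun _ _ => by positivity) _
    by_cases hxΩ : x ∈ Ω
    swap
    · rw [image_eq_zero_of_notMem_tsupport (fun h => hxΩ (hgΩ h)), mul_zero, norm_zero]
      exact hnn
    have hconst : ∀ a : ℝ, innerCutoff Ω δ =ᶠ[𝓝 x] (fun _ => a) →
        ‖lineDeriv ℝ (innerCutoff Ω δ) x v * g x‖ ≤ T.indicator (fun _ => δ⁻¹ * ε) x := by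
      intro a ha
      rw [ha.lineDeriv_eq]
      simpa [lineDeriv] using hnn
    rcases lt_or_ge (Metric.infDist x Ωᶜ) δ with hlt | hge
    · refine hconst 0 ?_
      filter_upwards [hdcont.continuousAt.eventually_lt continuousAt_const hlt] with y hy
      exact innerCutoff_eq_zero hδ hy.le
    rcases lt_or_ge (2 * δ) (Metric.infDist x Ωᶜ) with hlt | hle
    · refine hconst 1 ?_
      filter_upwards [continuousAt_const.eventually_lt hdcont.continuousAt hlt] with y hy
      exact innerCutoff_eq_one hδ hy.le
    · rw [indicator_of_mem (mem_cthickening_frontier hΩ hne hxΩ hle), norm_mul,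
        (hgh x hge).eq_of_nhds]
      have := norm_lineDeriv_le_of_lipschitz ℝ (x₀ := x) (v := v) hχ
      rw [hv, mul_one, Real.coe_toNNReal _ (by positivity)] at this
      exact mul_le_mul this (hhε x hxΩ) (norm_nonneg _) (by positivity)
  have hTi : Integrable (T.indicator fun _ => δ⁻¹ * ε) :=
    (integrable_indicator_iff hTc.measurableSet).2
      (integrableOn_const hTc.measure_lt_top.ne)
  refine (norm_integral_le_of_norm_le hTi (ae_of_all _ hbound)).trans ?_
  rw [integral_indicator hTc.measurableSet, setIntegral_const, smul_eq_mul]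
  have hvol : volume.real T ≤ C * (2 * δ) := by
    refine ENNReal.toReal_le_of_le_ofReal (by positivity) ?_
    refine (hC (2 * δ) (by positivity) hδ1).trans (le_of_eq ?_)
    rw [ENNReal.ofReal_mul C.coe_nonneg, ENNReal.ofReal_coe_nnreal]
  calc volume.real T * (δ⁻¹ * ε) ≤ C * (2 * δ) * (δ⁻¹ * ε) := by gcongr
    _ = 2 * C * ε := by field_simp

end innerCutoff

/-- The integral of the divergence of a field over a domain whose frontier has finite Minkowski
content is controlled by the supremum of the field. -/
theorem abs_integral_euclideanDiv_le {N : ℕ} {Ω : Set (Pt N)} (hΩ : IsOpen Ω)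
    (hbdd : Bornology.IsBounded Ω) (hne : Ωᶜ.Nonempty) {C : NNReal}
    (hC : ∀ δ : ℝ, 0 < δ → δ ≤ 1 →
      volume (Metric.cthickening δ (frontier Ω)) ≤ C * ENNReal.ofReal δ)
    {H : Pt N → Pt N} (hH : ContDiffOn ℝ 1 H Ω) {ε : ℝ} (hε : 0 ≤ ε)
    (hHε : ∀ x ∈ Ω, ‖H x‖ ≤ ε) (hint : IntegrableOn (euclideanDiv H) Ω) :
    |∫ x in Ω, euclideanDiv H x| ≤ N * (2 * C * ε) := by
  -- The factor `1 / 2` keeps `2 * δ k ≤ 1`, the range in which the Minkowski bound is available.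
  let δ : ℕ → ℝ := fun k => 1 / 2 / ((k : ℝ) + 1)
  have hδ0 : ∀ k, 0 < δ k := fun k => by positivity
  have hδ1 : ∀ k, 2 * δ k ≤ 1 := fun k => by
    have : 1 / 2 / ((k : ℝ) + 1) ≤ 1 / 2 :=
      div_le_self (by norm_num) (by linarith [k.cast_nonneg (α := ℝ)])
    simp only [δ]; linarith
  have hδt : Tendsto δ atTop (𝓝 0) := tendsto_const_div_atTop_nhds_zero_nat (1 / 2 : ℝ) |>.comp
    (tendsto_add_atTop_nat 1) |>.congr fun k => by simp [δ]
  have hlim : Tendsto (fun k => ∫ x in Ω, innerCutoff Ω (δ k) x * euclideanDiv H x) atTop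
      (𝓝 (∫ x in Ω, euclideanDiv H x)) := by
    refine tendsto_integral_of_dominated_convergence (fun x => ‖euclideanDiv H x‖) (fun k => ?_)
      hint.norm (fun k => ae_of_all _ fun x => ?_) ?_
    · exact (lipschitzWith_innerCutoff (hδ0 k)).continuous.aestronglyMeasurable.mul
        hint.aestronglyMeasurable
    · rw [norm_mul, Real.norm_of_nonneg (innerCutoff_nonneg x)]
      exact mul_le_of_le_one_left (norm_nonneg _) (innerCutoff_le_one x)
    · refine (ae_restrict_iff' hΩ.measurableSet).2 (ae_of_all _ fun x hx => ?_)
      have hpos : 0 < Metric.infDist x Ωᶜ :=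
        (hΩ.isClosed_compl.notMem_iff_infDist_pos hne).1 (fun h => h hx)
      refine tendsto_const_nhds.congr' ?_
      have h2 : Tendsto (fun k => 2 * δ k) atTop (𝓝 0) := by simpa using hδt.const_mul 2
      filter_upwards [h2.eventually_le_const hpos] with k hk
      rw [innerCutoff_eq_one (hδ0 k) hk, one_mul]
  refine le_of_tendsto hlim.abs (Eventually.of_forall fun k => ?_)
  have hcomp : ∀ j : Fin N, _ := fun j =>
    abs_integral_innerCutoff_mul_fderiv_le hΩ hbdd hne hC (h := fun y => H y j)
      (contDiffOn_euclidean.1 hH j) hε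
      (fun x hx => (PiLp.norm_apply_le (H x) j).trans (hHε x hx)) (hδ0 k) (hδ1 k)
      (v := EuclideanSpace.single j (1 : ℝ)) (by simp)
  simp only [euclideanDiv, Finset.mul_sum]
  rw [integral_finsetSum _ fun j _ => (hcomp j).1]
  calc |∑ j, ∫ x in Ω, innerCutoff Ω (δ k) x *
          fderiv ℝ (fun y => H y j) x (EuclideanSpace.single j 1)|
      ≤ ∑ j : Fin N, 2 * C * ε :=
        (Finset.abs_sum_le_sum_abs _ _).trans (Finset.sum_le_sum fun j _ => (hcomp j).2)
    _ = N * (2 * C * ε) := by simp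

/-! ### Finite fibres and projections along a coordinate axis -/

/-- A `C¹` map has finite fibres in a compact set none of whose points in the fibre is critical. -/
theorem finite_fiber_of_det_ne_zero {E : Type*} [NormedAddCommGroup E] [NormedSpace ℝ E]
    [FiniteDimensional ℝ E] {f : E → E} (hf : Differentiable ℝ f) {K : Set E} (hK : IsCompact K)
    {y : E} (hdet : ∀ t ∈ K, f t = y → (fderiv ℝ f t).det ≠ 0) : (K ∩ f ⁻¹' {y}).Finite := by
  by_contra hinf
  have hc : IsCompact (K ∩ f ⁻¹' {y}) := hK.inter_right (isClosed_singleton.preimage hf.continuous)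
  -- An infinite fibre would accumulate at some `t` in it, but an invertible derivative at `t` keeps
  -- nearby points from taking the value `y`.
  obtain ⟨t, ⟨htK, hty⟩, hacc⟩ :=
    Set.Infinite.exists_accPt_of_subset_isCompact hinf hc Subset.rfl
  let B := (fderiv ℝ f t).toContinuousLinearEquivOfDetNeZero (hdet t htK hty)
  have hB : ∃ C, AntilipschitzWith C (fderiv ℝ f t) := ⟨_, B.antilipschitz⟩
  rw [accPt_iff_frequently_nhdsNE] at hacc
  obtain ⟨s, hs, hs'⟩ := (hacc.and_eventually ((hf t).hasFDerivAt.eventually_ne (c := y) hB)).exists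
  exact hs' hs.2

section coordinates

variable {n : ℕ} (j : Fin (n + 1))

/-- The projection forgetting the coordinate `j`. -/
noncomputable def dropCoord : Pt (n + 1) →L[ℝ] Pt n :=
  LinearMap.toContinuousLinearMap
    { toFun := fun x => WithLp.toLp 2 fun a => x (j.succAbove a)
      map_add' := fun x y => by ext; simp
      map_smul' := fun c x => by ext; simp }

@[simp]
theorem dropCoord_apply (x : Pt (n + 1)) (a : Fin n) : dropCoord j x a = x (j.succAbove a) := rfl

/-- The identification of `ℝ × ℝ^n` with `ℝ^(n+1)` that inserts the first factor as the
coordinate `j`. -/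
def insertCoord : ℝ × Pt n ≃ᵐ Pt (n + 1) :=
  ((MeasurableEquiv.refl ℝ).prodCongr (MeasurableEquiv.toLp 2 (Fin n → ℝ)).symm).trans
    ((MeasurableEquiv.piFinSuccAbove (fun _ => ℝ) j).symm.trans
      (MeasurableEquiv.toLp 2 (Fin (n + 1) → ℝ)))

theorem insertCoord_apply (s : ℝ) (y : Pt n) :
    insertCoord j (s, y) = WithLp.toLp 2 (j.insertNth s fun a => y a) := rfl

@[simp]
theorem insertCoord_apply_self (s : ℝ) (y : Pt n) : insertCoord j (s, y) j = s := by
  simp [insertCoord_apply]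

@[simp]
theorem dropCoord_insertCoord (s : ℝ) (y : Pt n) : dropCoord j (insertCoord j (s, y)) = y := by
  ext a
  simp [insertCoord_apply]

theorem insertCoord_coord_dropCoord (x : Pt (n + 1)) : insertCoord j (x j, dropCoord j x) = x := by
  ext a
  refine Fin.succAboveCases j ?_ (fun a => ?_) a <;> simp [insertCoord_apply]

theorem insertCoord_add (s r : ℝ) (y : Pt n) :
    insertCoord j (s + r, y) = insertCoord j (s, y) + r • EuclideanSpace.single j (1 : ℝ) := by
  ext a
  refine Fin.succAboveCases j ?_ (fun a => ?_) a
  · simp [insertCoord_apply]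
  · simp [insertCoord_apply]

theorem insertCoord_eq (s : ℝ) (y : Pt n) :
    insertCoord j (s, y) = insertCoord j (0, y) + s • EuclideanSpace.single j (1 : ℝ) := by
  rw [← insertCoord_add, zero_add]

theorem measurePreserving_insertCoord :
    MeasurePreserving (insertCoord j) (volume.prod volume) volume := by
  have h1 : MeasurePreserving (Prod.map id (WithLp.ofLp : Pt n → Fin n → ℝ))
      ((volume : Measure ℝ).prod volume) (volume.prod volume) :=
    (MeasurePreserving.id volume).prod (PiLp.volume_preserving_ofLp (Fin n))
  exact (PiLp.volume_preserving_toLp (Fin (n + 1))).comp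
    ((volume_preserving_piFinSuccAbove (fun _ : Fin (n + 1) => ℝ) j).symm.comp h1)

/-- Expanding the determinant along its first column, a basis vector, leaves the minor without row
`j`, which is the Jacobian of the projected chart. The absolute value discards the sign of the
expansion. -/
theorem abs_contraction_single_tangentFrame {φ : Pt n → Pt (n + 1)} {t : Pt n}
    (hφ : DifferentiableAt ℝ φ t) :
    |contraction (EuclideanSpace.single j (1 : ℝ)) (tangentFrame φ t)| =
      |(fderiv ℝ (fun s => dropCoord j (φ s)) t).det| := by
  have hfd : fderiv ℝ (fun s => dropCoord j (φ s)) t = (dropCoord j).comp (fderiv ℝ φ t) :=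
    ((dropCoord j).hasFDerivAt.comp t hφ.hasFDerivAt).fderiv
  have hdet : (fderiv ℝ (fun s => dropCoord j (φ s)) t).det =
      (Matrix.of fun a b => tangentFrame φ t b (j.succAbove a)).det := by
    rw [hfd, ContinuousLinearMap.det,
      ← LinearMap.det_toMatrix (EuclideanSpace.basisFun (Fin n) ℝ).toBasis]
    rfl
  have hvol : contraction (EuclideanSpace.single j (1 : ℝ)) (tangentFrame φ t) =
      (Matrix.of fun a b => Matrix.vecCons (EuclideanSpace.single j (1 : ℝ))
        (tangentFrame φ t) b a).det := by
    rw [contraction, AlternatingMap.curryLeft_apply_apply, volForm, Module.Basis.det_apply]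
    rfl
  rw [hvol, hdet, Matrix.det_succ_column_zero, Finset.sum_eq_single j]
  · rw [abs_mul, abs_mul, abs_pow, abs_neg, abs_one, one_pow]
    simp only [Matrix.of_apply, Matrix.cons_val_zero, PiLp.single_apply, if_true, abs_one, one_mul]
    rfl
  · intro i _ hi
    simp [hi]
  · simp

end coordinates

/-! ### The divergence theorem for axis-parallel C¹ fields, by slicing -/

section slices

variable {n : ℕ} {Ω : Set (Pt (n + 1))} (S : PiecewiseSmoothBoundary Ω) (j : Fin (n + 1))

/-- The value of the form `⟨∂/∂x_j, dν⟩` on the tangent frame of the piece `i` of the boundary. -/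
noncomputable def frameCofactor (i : Fin S.m) (t : Pt n) : ℝ :=
  contraction (EuclideanSpace.single j (1 : ℝ)) (tangentFrame (S.φ i) t)

/-- The regular part of the piece `i` of the boundary with respect to the projection in the
direction `j`. -/
def regularPart (i : Fin S.m) : Set (Pt n) :=
  interior (S.K i) ∩ {t | frameCofactor S j i t ≠ 0}

theorem continuous_tangentFrame {φ : Pt n → Pt (n + 1)} (hφ : ContDiff ℝ 1 φ) :
    Continuous (tangentFrame φ) :=
  continuous_pi fun _ => (hφ.continuous_fderiv one_ne_zero).clm_apply continuous_const

theorem continuous_contraction_apply (w : Pt (n + 1)) :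
    Continuous fun v : Fin n → Pt (n + 1) => contraction w v := by
  have h : ∀ v : Fin n → Pt (n + 1), contraction w v =
      (Matrix.of fun a b => (Matrix.vecCons w v : Fin (n + 1) → Pt (n + 1)) b a).det := fun v => by
    rw [contraction, AlternatingMap.curryLeft_apply_apply, volForm, Module.Basis.det_apply]
    rfl
  simp only [h]
  refine Continuous.matrix_det (continuous_matrix fun a b => ?_)
  induction b using Fin.cases with
  | zero => exact (continuous_const : Continuous fun _ : Fin n → Pt (n + 1) => w a)
  | succ b =>
    exact (EuclideanSpace.proj a : Pt (n + 1) →L[ℝ] ℝ).continuous.comp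
      (continuous_apply b)

variable (hS : ∀ i, ContDiff ℝ 1 (S.φ i))

include hS

theorem continuous_frameCofactor (i : Fin S.m) : Continuous (frameCofactor S j i) :=
  (continuous_contraction_apply _).comp (continuous_tangentFrame (hS i))

theorem measurableSet_regularPart (i : Fin S.m) : MeasurableSet (regularPart S j i) :=
  isOpen_interior.measurableSet.inter
    ((isOpen_compl_singleton.preimage (continuous_frameCofactor S j hS i)).measurableSet)

theorem contDiff_dropCoord_comp (i : Fin S.m) : ContDiff ℝ 1 fun s => dropCoord j (S.φ i s) :=
  (dropCoord j).contDiff.comp (hS i)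

theorem abs_frameCofactor (i : Fin S.m) (t : Pt n) :
    |frameCofactor S j i t| = |(fderiv ℝ (fun s => dropCoord j (S.φ i s)) t).det| :=
  abs_contraction_single_tangentFrame j ((hS i).differentiable one_ne_zero t)

/-- Almost every line in the direction `j` meets the boundary at interior regular points only. -/
theorem ae_forall_mem_regularPart :
    ∀ᵐ y : Pt n, ∀ i, ∀ t ∈ S.K i, dropCoord j (S.φ i t) = y → t ∈ regularPart S j i := by
  rw [ae_all_iff]
  intro i
  have hd := (contDiff_dropCoord_comp S j hS i).differentiable one_ne_zero
  -- Two null sets of lines are excluded: a differentiable map between spaces of equal dimension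
  -- sends the null set `frontier (S.K i)` to a null set, and critical values are null by Sard's
  -- theorem.
  have h1 : volume ((fun s => dropCoord j (S.φ i s)) '' frontier (S.K i)) = 0 :=
    addHaar_image_eq_zero_of_differentiableOn_of_addHaar_eq_zero _ hd.differentiableOn
      (S.null_frontier i)
  have h2 : volume ((fun s => dropCoord j (S.φ i s)) '' {t | frameCofactor S j i t = 0}) = 0 :=
    addHaar_image_eq_zero_of_det_fderivWithin_eq_zero _
      (fun t _ => (hd t).hasFDerivAt.hasFDerivWithinAt) fun t ht => by
        rw [← abs_eq_zero, ← abs_frameCofactor S j hS, abs_eq_zero]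
        exact ht
  filter_upwards [measure_eq_zero_iff_ae_notMem.1 h1, measure_eq_zero_iff_ae_notMem.1 h2]
    with y hy1 hy2 t ht hty
  refine ⟨?_, fun h => hy2 ⟨t, h, hty⟩⟩
  by_contra h
  exact hy1 ⟨t, ⟨subset_closure ht, h⟩, hty⟩

theorem finite_regularPart_fiber {y : Pt n}
    (hy : ∀ i, ∀ t ∈ S.K i, dropCoord j (S.φ i t) = y → t ∈ regularPart S j i) (i : Fin S.m) :
    (regularPart S j i ∩ (fun s => dropCoord j (S.φ i s)) ⁻¹' {y}).Finite := by
  refine (finite_fiber_of_det_ne_zero ((contDiff_dropCoord_comp S j hS i).differentiable one_ne_zero)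
    (S.isCompact i) (y := y) fun t ht hty => ?_).subset
      (inter_subset_inter_left _ (inter_subset_left.trans interior_subset))
  rw [← abs_ne_zero, ← abs_frameCofactor S j hS, abs_ne_zero]
  exact (hy i t ht hty).2

omit hS in
/-- At a regular boundary point the line in the direction `j` crosses the boundary, in the
direction given by the sign of the cofactor. -/
theorem isCrossing_of_mem_regularPart {i : Fin S.m} {t : Pt n} (ht : t ∈ regularPart S j i) :
    IsCrossing {s | insertCoord j (s, dropCoord j (S.φ i t)) ∈ Ω}
      (SignType.sign (frameCofactor S j i t) : ℝ) (S.φ i t j) := by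
  have hline : ∀ r : ℝ, insertCoord j (S.φ i t j + r, dropCoord j (S.φ i t)) =
      S.φ i t + r • EuclideanSpace.single j (1 : ℝ) := fun r => by
    rw [insertCoord_add, insertCoord_coord_dropCoord]
  -- Used with `w = ±1` of the same sign as the cofactor, so that `w • e_j` completes the tangent
  -- frame to a positive basis and hence points outwards.
  have key : ∀ w : ℝ, 0 < w * frameCofactor S j i t → ∃ ε > 0, ∀ r : ℝ, 0 < r → r < ε →
      insertCoord j (S.φ i t j + r * w, dropCoord j (S.φ i t)) ∉ Ω ∧
        insertCoord j (S.φ i t j - r * w, dropCoord j (S.φ i t)) ∈ Ω := by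
    intro w hw
    obtain ⟨ε, hε, h⟩ := S.oriented i t ht.1 (w • EuclideanSpace.single j (1 : ℝ)) (by
      rwa [contraction, map_smul, AlternatingMap.smul_apply, smul_eq_mul])
    refine ⟨ε, hε, fun r hr hrε => ?_⟩
    rw [sub_eq_add_neg, hline, hline, neg_smul, ← sub_eq_add_neg, mul_smul]
    exact ⟨fun h' => (h r hr hrε).1 (subset_closure h'), (h r hr hrε).2⟩
  rcases lt_or_gt_of_ne ht.2 with hneg | hpos
  · obtain ⟨ε, hε, h⟩ := key (-1) (by linarith)
    refine Or.inr ⟨by simp [sign_neg hneg], ?_, ?_⟩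
    · filter_upwards [Ioo_mem_nhdsLT (sub_lt_self (S.φ i t j) hε)] with s hs
      have := (h (S.φ i t j - s) (by linarith [hs.2]) (by linarith [hs.1])).1
      rwa [mul_neg_one, neg_sub, add_sub_cancel] at this
    · filter_upwards [Ioo_mem_nhdsGT (lt_add_of_pos_right (S.φ i t j) hε)] with s hs
      have := (h (s - S.φ i t j) (by linarith [hs.1]) (by linarith [hs.2])).2
      rwa [mul_neg_one, sub_neg_eq_add, add_sub_cancel] at this
  · obtain ⟨ε, hε, h⟩ := key 1 (by linarith)
    refine Or.inl ⟨by simp [sign_pos hpos], ?_, ?_⟩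
    · filter_upwards [Ioo_mem_nhdsLT (sub_lt_self (S.φ i t j) hε)] with s hs
      have := (h (S.φ i t j - s) (by linarith [hs.2]) (by linarith [hs.1])).2
      rwa [mul_one, sub_sub_cancel] at this
    · filter_upwards [Ioo_mem_nhdsGT (lt_add_of_pos_right (S.φ i t j) hε)] with s hs
      have := (h (s - S.φ i t j) (by linarith [hs.1]) (by linarith [hs.2])).1
      rwa [mul_one, add_sub_cancel] at this

omit hS in
theorem contDiff_insertCoord_left (y : Pt n) : ContDiff ℝ ∞ fun s : ℝ => insertCoord j (s, y) := by
  have : (fun s : ℝ => insertCoord j (s, y)) = fun s =>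
      insertCoord j (0, y) + s • EuclideanSpace.single j (1 : ℝ) := by
    ext1 s
    exact insertCoord_eq j s y
  rw [this]
  fun_prop

omit hS in
theorem deriv_comp_insertCoord {g : Pt (n + 1) → ℝ} (hg : Differentiable ℝ g) (s : ℝ) (y : Pt n) :
    deriv (fun s => g (insertCoord j (s, y))) s =
      fderiv ℝ g (insertCoord j (s, y)) (EuclideanSpace.single j 1) := by
  have h : HasDerivAt (fun s : ℝ => insertCoord j (s, y)) (EuclideanSpace.single j (1 : ℝ)) s := by
    have : (fun s : ℝ => insertCoord j (s, y)) = fun s =>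
        insertCoord j (0, y) + s • EuclideanSpace.single j (1 : ℝ) := by
      ext1 s
      exact insertCoord_eq j s y
    rw [this]
    simpa using ((hasDerivAt_id s).smul_const (EuclideanSpace.single j (1 : ℝ))).const_add
      (insertCoord j (0, y))
  exact ((hg _).hasFDerivAt.comp_hasDerivAt s h).deriv

/-- The fundamental theorem of calculus on almost every line in the direction `j`. -/
theorem setIntegral_line_eq_sum (hΩ : IsOpen Ω) (hbdd : Bornology.IsBounded Ω)
    {g : Pt (n + 1) → ℝ} (hg : ContDiff ℝ 1 g) {y : Pt n}
    (hy : ∀ i, ∀ t ∈ S.K i, dropCoord j (S.φ i t) = y → t ∈ regularPart S j i) :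
    ∫ s in {s | insertCoord j (s, y) ∈ Ω},
        fderiv ℝ g (insertCoord j (s, y)) (EuclideanSpace.single j 1) =
      ∑ i, ∑ᶠ t ∈ regularPart S j i ∩ (fun s => dropCoord j (S.φ i s)) ⁻¹' {y},
        (SignType.sign (frameCofactor S j i t) : ℝ) * g (S.φ i t) := by
  classical
  set A : Set ℝ := {s | insertCoord j (s, y) ∈ Ω} with hA
  have hcont : Continuous fun s : ℝ => insertCoord j (s, y) :=
    (contDiff_insertCoord_left j y).continuous
  have hAo : IsOpen A := hΩ.preimage hcont
  have hAb : Bornology.IsBounded A := by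
    have h1 : Bornology.IsBounded ((EuclideanSpace.proj j : Pt (n + 1) →L[ℝ] ℝ) '' Ω) :=
      (EuclideanSpace.proj j : Pt (n + 1) →L[ℝ] ℝ).lipschitz.isBounded_image hbdd
    exact h1.subset fun s hs => ⟨_, hs, by simp⟩
  have hfin := finite_regularPart_fiber S j hS hy
  let I : Finset (Σ _ : Fin S.m, Pt n) := Finset.univ.sigma fun i => (hfin i).toFinset
  have hI : ∀ z ∈ I, z.2 ∈ regularPart S j z.1 ∧ dropCoord j (S.φ z.1 z.2) = y := by
    intro z hz
    simpa [I] using hz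
  let p : (Σ _ : Fin S.m, Pt n) → ℝ := fun z => S.φ z.1 z.2 j
  have hp : InjOn p I := by
    rintro ⟨i, t⟩ hz ⟨i', t'⟩ hz' h
    obtain ⟨h1, h2⟩ := hI _ hz
    obtain ⟨h1', h2'⟩ := hI _ hz'
    have : S.φ i t = S.φ i' t' := by
      rw [← insertCoord_coord_dropCoord j (S.φ i t), ← insertCoord_coord_dropCoord j (S.φ i' t')]
      simp only [p] at h h2 h2'
      rw [h, h2, h2']
    obtain ⟨rfl, rfl⟩ := S.simple i i' t h1.1 t' (interior_subset h1'.1) this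
    rfl
  let ε : (Σ _ : Fin S.m, Pt n) → ℝ := fun z => (SignType.sign (frameCofactor S j z.1 z.2) : ℝ)
  -- The sign as a function of the height on the line: `p` is injective on `I` because the boundary
  -- has no self-intersections, so at heights in `p '' I` the sum has a single term.
  let e : ℝ → ℝ := fun s => ∑ z ∈ I with p z = s, ε z
  have he : ∀ z ∈ I, e (p z) = ε z := by
    intro z hz
    have : I.filter (fun z' => p z' = p z) = {z} := by
      ext z'
      simp only [Finset.mem_filter, Finset.mem_singleton]
      refine ⟨fun h => hp h.1 hz h.2, ?_⟩
      rintro rfl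
      exact ⟨hz, rfl⟩
    simp only [e, this, Finset.sum_singleton]
  have hfr : frontier A ⊆ I.image p := by
    intro s hs
    have h1 : insertCoord j (s, y) ∈ frontier Ω := hcont.frontier_preimage_subset Ω hs
    rw [S.frontier_eq] at h1
    obtain ⟨i, t, ht, hts⟩ := mem_iUnion.1 h1
    have hty : dropCoord j (S.φ i t) = y := by rw [hts, dropCoord_insertCoord]
    rw [Finset.mem_coe, Finset.mem_image]
    refine ⟨⟨i, t⟩, ?_, by simp [p, hts]⟩
    simpa [I] using ⟨hy i t ht hty, hty⟩
  have hcr : ∀ s ∈ I.image p, IsCrossing A (e s) s := by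
    intro s hs
    obtain ⟨z, hz, rfl⟩ := Finset.mem_image.1 hs
    rw [he z hz]
    have := isCrossing_of_mem_regularPart S j (hI z hz).1
    rwa [(hI z hz).2] at this
  have hf : ContDiff ℝ 1 fun s : ℝ => g (insertCoord j (s, y)) :=
    hg.comp ((contDiff_insertCoord_left j y).of_le (by norm_cast))
  have hmain := setIntegral_deriv_eq_sum_of_isCrossing hf e (I.image p) hAo hAb hfr hcr
  simp only [deriv_comp_insertCoord j (hg.differentiable one_ne_zero)] at hmain
  rw [hmain, Finset.sum_image hp, Finset.sum_sigma]
  refine Finset.sum_congr rfl fun i _ => ?_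
  rw [finsum_mem_eq_finite_toFinset_sum _ (hfin i)]
  refine Finset.sum_congr rfl fun t ht => ?_
  have hz : (⟨i, t⟩ : Σ _ : Fin S.m, Pt n) ∈ I := Finset.mem_sigma.2 ⟨Finset.mem_univ _, ht⟩
  rw [he _ hz]
  have : insertCoord j (p ⟨i, t⟩, y) = S.φ i t := by
    rw [← (hI _ hz).2]
    exact insertCoord_coord_dropCoord j _
  rw [this]

/-- The divergence theorem for a field of class `C¹` on the whole space that is parallel to a
coordinate axis. -/
theorem setIntegral_fderiv_single_eq_sum (hΩ : IsOpen Ω) (hbdd : Bornology.IsBounded Ω)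
    {g : Pt (n + 1) → ℝ} (hg : ContDiff ℝ 1 g) :
    ∫ x in Ω, fderiv ℝ g x (EuclideanSpace.single j 1) =
      ∑ i, ∫ t in S.K i, g (S.φ i t) * frameCofactor S j i t := by
  have hgood := ae_forall_mem_regularPart S j hS
  have harea := fun i => setIntegral_abs_det_smul_eq_integral_finsum (μ := volume)
    (measurableSet_regularPart S j hS i)
    (fun t _ => ((contDiff_dropCoord_comp S j hS i).differentiable
      one_ne_zero t).hasFDerivAt.hasFDerivWithinAt)
    (fun t ht => by
      rw [← abs_ne_zero, ← abs_frameCofactor S j hS, abs_ne_zero]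
      exact ht.2)
    (h := fun t => (SignType.sign (frameCofactor S j i t) : ℝ) * g (S.φ i t))
  -- The Jacobian weight of the area formula times the crossing sign is the signed cofactor, that
  -- is, the coefficient in the pullback of the boundary form.
  have hpt : ∀ i t, |(fderiv ℝ (fun s => dropCoord j (S.φ i s)) t).det| •
      ((SignType.sign (frameCofactor S j i t) : ℝ) * g (S.φ i t)) =
        g (S.φ i t) * frameCofactor S j i t := fun i t => by
    rw [← abs_frameCofactor S j hS, smul_eq_mul, ← mul_assoc, abs_mul_sign, mul_comm]
  simp only [hpt] at harea
  have hcont : ∀ i, Continuous fun t => g (S.φ i t) * frameCofactor S j i t := fun i =>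
    (hg.continuous.comp (hS i).continuous).mul (continuous_frameCofactor S j hS i)
  have hreg : ∀ i, ∫ t in S.K i, g (S.φ i t) * frameCofactor S j i t =
      ∫ t in regularPart S j i, g (S.φ i t) * frameCofactor S j i t := by
    intro i
    rw [setIntegral_congr_set (interior_ae_eq_of_null_frontier (S.null_frontier i)).symm]
    refine setIntegral_eq_of_subset_of_forall_sdiff_eq_zero isOpen_interior.measurableSet
      inter_subset_left fun t ht => ?_
    have : frameCofactor S j i t = 0 := by
      by_contra h
      exact ht.2 ⟨ht.1, h⟩
    rw [this, mul_zero]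
  have harea' := fun i => harea i
    ((hcont i).continuousOn.integrableOn_compact (S.isCompact i) |>.mono_set
      (inter_subset_left.trans interior_subset))
    (hgood.mono fun y hy => finite_regularPart_fiber S j hS hy i)
  simp only [hreg]
  rw [Finset.sum_congr rfl fun i _ => (harea' i).2, ← integral_finsetSum _ fun i _ => (harea' i).1]
  have hD : Continuous fun x => fderiv ℝ g x (EuclideanSpace.single j 1) :=
    (hg.continuous_fderiv one_ne_zero).clm_apply continuous_const
  have hint : Integrable (Ω.indicator fun x => fderiv ℝ g x (EuclideanSpace.single j 1)) :=
    (integrable_indicator_iff hΩ.measurableSet).2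
      ((hD.continuousOn.integrableOn_compact hbdd.isCompact_closure).mono_set subset_closure)
  rw [← integral_indicator hΩ.measurableSet, ← (measurePreserving_insertCoord j).integral_comp']
  refine (integral_prod_symm _ (((measurePreserving_insertCoord j).integrable_comp_emb
    (insertCoord j).measurableEmbedding).2 hint)).trans ?_
  refine integral_congr_ae ?_
  filter_upwards [hgood] with y hy
  rw [← setIntegral_line_eq_sum S j hS hΩ hbdd hg hy, ← integral_indicator]
  · rfl
  · exact hΩ.measurableSet.preimage ((contDiff_insertCoord_left j y).continuous.measurable)

end slices

/-! ### The divergence theorem for fields continuous up to the boundary -/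

section divergence

variable {n : ℕ} {Ω : Set (Pt (n + 1))}

/-- A piecewise smooth boundary can be presented by globally defined `C¹` Lipschitz maps. -/
theorem PiecewiseSmoothBoundary.exists_contDiff_lipschitzWith (S : PiecewiseSmoothBoundary Ω) :
    ∃ S' : PiecewiseSmoothBoundary Ω,
      (∀ i, ContDiff ℝ 1 (S'.φ i)) ∧ (∀ i, ∃ L, LipschitzWith L (S'.φ i)) ∧
        ∀ η : Pt (n + 1) → Pt (n + 1) [⋀^Fin n]→ₗ[ℝ] ℝ, S'.integral η = S.integral η := by
  have key : ∀ i, ∃ g : Pt n → Pt (n + 1), ContDiff ℝ 1 g ∧ HasCompactSupport g ∧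
      ∀ t ∈ S.K i, g =ᶠ[𝓝 t] S.φ i := by
    intro i
    obtain ⟨U, hU, hKU, hφ⟩ := S.contDiff i
    obtain ⟨g, h1, h2, -, h3⟩ :=
      exists_contDiff_hasCompactSupport_eventuallyEq (S.isCompact i) hU hKU hφ
    exact ⟨g, h1, h2, h3⟩
  choose g hg hgs hgφ using key
  have heq : ∀ i, ∀ t ∈ S.K i, g i t = S.φ i t := fun i t ht => (hgφ i t ht).eq_of_nhds
  have hfd : ∀ i, ∀ t ∈ S.K i, fderiv ℝ (g i) t = fderiv ℝ (S.φ i) t :=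
    fun i t ht => (hgφ i t ht).fderiv_eq
  have hfr : ∀ i, ∀ t ∈ S.K i, tangentFrame (g i) t = tangentFrame (S.φ i) t := fun i t ht =>
    funext fun j => DFunLike.congr_fun (hfd i t ht) _
  refine ⟨{
    m := S.m
    K := S.K
    φ := g
    frontier_eq := by
      rw [S.frontier_eq]
      exact iUnion_congr fun i => (image_congr (heq i)).symm
    isCompact := S.isCompact
    null_frontier := S.null_frontier
    contDiff := fun i => ⟨univ, isOpen_univ, subset_univ _, (hg i).contDiffOn⟩
    immersion := fun i t ht => by
      rw [hfd i t (interior_subset ht)]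
      exact S.immersion i t ht
    simple := fun i j t ht s hs h => by
      rw [heq i t (interior_subset ht), heq j s hs] at h
      exact S.simple i j t ht s hs h
    oriented := fun i t ht w hw => by
      rw [hfr i t (interior_subset ht)] at hw
      rw [heq i t (interior_subset ht)]
      exact S.oriented i t ht w hw }, hg, fun i => ?_, fun η => ?_⟩
  · exact ContDiff.lipschitzWith_of_hasCompactSupport (hgs i) (hg i) one_ne_zero
  · refine Finset.sum_congr rfl fun i _ => ?_
    refine setIntegral_congr_fun (S.isCompact i).measurableSet fun t ht => ?_
    simp only [heq i t ht, hfr i t ht]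

/-- A boundary that is presented by Lipschitz maps has finite Minkowski content. -/
theorem exists_volume_cthickening_frontier_le (S : PiecewiseSmoothBoundary Ω)
    (hL : ∀ i, ∃ L, LipschitzWith L (S.φ i)) :
    ∃ C : NNReal, ∀ δ : ℝ, 0 < δ → δ ≤ 1 →
      volume (Metric.cthickening δ (frontier Ω)) ≤ C * ENNReal.ofReal δ := by
  have key : ∀ i, ∃ C : NNReal, ∀ δ : ℝ, 0 < δ → δ ≤ 1 →
      volume (Metric.cthickening δ (S.φ i '' S.K i)) ≤ C * ENNReal.ofReal δ := fun i => by
    obtain ⟨L, hL⟩ := hL i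
    exact hL.exists_measure_cthickening_image_le volume volume (by simp) (S.isCompact i)
  choose C hC using key
  refine ⟨∑ i, C i, fun δ hδ hδ1 => ?_⟩
  have hc : ∀ i, IsCompact (S.φ i '' S.K i) := fun i =>
    (S.isCompact i).image (hL i).choose_spec.continuous
  have hsub : Metric.cthickening δ (frontier Ω) ⊆
      ⋃ i, Metric.cthickening δ (S.φ i '' S.K i) := by
    rw [S.frontier_eq, (isCompact_iUnion hc).cthickening_eq_biUnion_closedBall hδ.le]
    refine iUnion₂_subset fun y hy x hx => ?_
    obtain ⟨i, hi⟩ := mem_iUnion.1 hy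
    exact mem_iUnion.2 ⟨i, Metric.mem_cthickening_of_dist_le x y δ _ hi hx⟩
  calc volume (Metric.cthickening δ (frontier Ω))
      ≤ ∑ i, volume (Metric.cthickening δ (S.φ i '' S.K i)) :=
        (measure_mono hsub).trans (measure_iUnion_fintype_le _ _)
    _ ≤ ∑ i, C i * ENNReal.ofReal δ := Finset.sum_le_sum fun i _ => hC i δ hδ hδ1
    _ = _ := by rw [← Finset.sum_mul]; push_cast; rfl

/-- The contraction of the volume form as a linear function of the contracted vector. -/
noncomputable def contractionApply (v : Fin n → Pt (n + 1)) : Pt (n + 1) →ₗ[ℝ] ℝ where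
  toFun w := contraction w v
  map_add' w w' := by rw [contraction, map_add]; rfl
  map_smul' c w := by rw [contraction, map_smul]; rfl

theorem contraction_eq_sum (w : Pt (n + 1)) (v : Fin n → Pt (n + 1)) :
    contraction w v = ∑ j, w j * contraction (EuclideanSpace.single j (1 : ℝ)) v := by
  have hw : w = ∑ j, w j • EuclideanSpace.single j (1 : ℝ) := by
    ext a
    simp [Pi.single_apply]
  conv_lhs => rw [hw]
  change contractionApply v _ = ∑ j, w j * contractionApply v _
  simp [map_sum]

theorem PiecewiseSmoothBoundary.continuousOn_φ (S : PiecewiseSmoothBoundary Ω) (i : Fin S.m) :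
    ContinuousOn (S.φ i) (S.K i) := by
  obtain ⟨U, -, hKU, hφ⟩ := S.contDiff i
  exact hφ.continuousOn.mono hKU

theorem PiecewiseSmoothBoundary.mapsTo_φ (S : PiecewiseSmoothBoundary Ω) (i : Fin S.m) :
    MapsTo (S.φ i) (S.K i) (closure Ω) := fun t ht =>
  frontier_subset_closure (S.frontier_eq ▸ mem_iUnion.2 ⟨i, t, ht, rfl⟩)

theorem PiecewiseSmoothBoundary.continuousOn_tangentFrame (S : PiecewiseSmoothBoundary Ω)
    (i : Fin S.m) : ContinuousOn (tangentFrame (S.φ i)) (S.K i) := by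
  obtain ⟨U, hU, hKU, hφ⟩ := S.contDiff i
  exact continuousOn_pi.2 fun _ =>
    ((hφ.continuousOn_fderiv_of_isOpen hU le_rfl).mono hKU).clm_apply continuousOn_const

theorem PiecewiseSmoothBoundary.continuousOn_contraction_comp (S : PiecewiseSmoothBoundary Ω)
    {F : Pt (n + 1) → Pt (n + 1)} (hF : ContinuousOn F (closure Ω)) (i : Fin S.m) :
    ContinuousOn (fun t => contraction (F (S.φ i t)) (tangentFrame (S.φ i) t)) (S.K i) := by
  simp only [contraction_eq_sum (F _)]
  refine continuousOn_finsetSum _ fun j _ => ContinuousOn.mul ?_ ?_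
  · exact (EuclideanSpace.proj j : Pt (n + 1) →L[ℝ] ℝ).continuous.comp_continuousOn
      (hF.comp (S.continuousOn_φ i) (S.mapsTo_φ i))
  · exact (continuous_contraction_apply _).comp_continuousOn (S.continuousOn_tangentFrame i)

/-- Adding the axis-parallel cases gives this, since the contraction is linear in the contracted
vector; integrability is automatic because the derivatives are continuous on the compact closure. -/
theorem setIntegral_euclideanDiv_eq_of_contDiff (hΩ : IsOpen Ω) (hbdd : Bornology.IsBounded Ω)
    (S : PiecewiseSmoothBoundary Ω) (hS : ∀ i, ContDiff ℝ 1 (S.φ i))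
    {G : Pt (n + 1) → Pt (n + 1)} (hG : ContDiff ℝ 1 G) :
    IntegrableOn (euclideanDiv G) Ω ∧
      ∫ x in Ω, euclideanDiv G x = S.integral fun x => contraction (G x) := by
  have hGj : ∀ j, ContDiff ℝ 1 fun x => G x j := contDiff_euclidean.1 hG
  have hint : ∀ j, IntegrableOn
      (fun x => fderiv ℝ (fun y => G y j) x (EuclideanSpace.single j 1)) Ω := fun j =>
    ((((hGj j).continuous_fderiv one_ne_zero).clm_apply
      continuous_const).continuousOn.integrableOn_compact hbdd.isCompact_closure).mono_set
        subset_closure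
  refine ⟨integrable_finsetSum _ fun j _ => hint j, ?_⟩
  simp only [euclideanDiv]
  rw [integral_finsetSum _ fun j _ => hint j, PiecewiseSmoothBoundary.integral]
  simp only [setIntegral_fderiv_single_eq_sum S _ hS hΩ hbdd (hGj _)]
  rw [Finset.sum_comm]
  refine Finset.sum_congr rfl fun i _ => ?_
  simp only [contraction_eq_sum (G _)]
  rw [integral_finsetSum]
  · rfl
  · intro j _
    exact (((hGj j).continuous.comp (hS i).continuous).mul
      (continuous_frameCofactor S j hS i)).continuousOn.integrableOn_compact (S.isCompact i)

/-- The divergence theorem on a domain with piecewise smooth boundary, for a field that is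
continuous on the closure, of class `C¹` in the interior, and has integrable divergence. -/
theorem setIntegral_euclideanDiv_eq (hΩ : IsOpen Ω) (hbdd : Bornology.IsBounded Ω)
    (S : PiecewiseSmoothBoundary Ω) {F : Pt (n + 1) → Pt (n + 1)}
    (hFc : ContinuousOn F (closure Ω)) (hF : ContDiffOn ℝ 1 F Ω)
    (hint : IntegrableOn (euclideanDiv F) Ω) :
    ∫ x in Ω, euclideanDiv F x = S.integral fun x => contraction (F x) := by
  obtain ⟨S', hS', hL, hSS'⟩ := S.exists_contDiff_lipschitzWith
  rw [← hSS']
  clear hSS'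
  obtain ⟨C, hC⟩ := exists_volume_cthickening_frontier_le S' hL
  have hne : Ωᶜ.Nonempty := by
    rw [nonempty_compl]
    rintro rfl
    exact NormedSpace.unbounded_univ ℝ (Pt (n + 1)) hbdd
  -- If `F` changes by at most `ε`, the boundary integral changes by at most `ε * M` and the volume
  -- integral by at most `ε * ((n + 1) * (2 * C))`.
  set M : ℝ := ∑ i, ∫ t in S'.K i, ∑ j, |frameCofactor S' j i t|
  set B : ℝ := ((n + 1 : ℕ) : ℝ) * (2 * C) + M
  have hB : 0 ≤ B := add_nonneg (by positivity)
    (Finset.sum_nonneg fun i _ => integral_nonneg fun t => by positivity)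
  have key : ∀ ε > 0, |(∫ x in Ω, euclideanDiv F x) - S'.integral fun x => contraction (F x)| ≤
      ε * B := by
    intro ε hε
    -- Tietze's extension theorem followed by smooth approximation yields a global `G` within `ε` of
    -- `F` on the closure.
    obtain ⟨F', hF'⟩ := ContinuousMap.exists_restrict_eq isClosed_closure
      (⟨(closure Ω).domRestrict F, hFc.domRestrict⟩ : C(closure Ω, Pt (n + 1)))
    have hFF' : ∀ x ∈ closure Ω, F' x = F x := fun x hx => by
      have := DFunLike.congr_fun hF' ⟨x, hx⟩
      exact this
    obtain ⟨G, hG, hGF, -⟩ := F'.continuous.exists_contDiff_approx 1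
      (continuous_const : Continuous fun _ : Pt (n + 1) => ε) (fun _ => hε)
    have hFG : ∀ x ∈ closure Ω, ‖F x - G x‖ ≤ ε := fun x hx => by
      rw [← hFF' x hx, norm_sub_rev, ← dist_eq_norm]
      exact (hGF x).le
    have hG1 : ContDiff ℝ 1 G := by simpa using hG
    obtain ⟨hGi, hGe⟩ := setIntegral_euclideanDiv_eq_of_contDiff hΩ hbdd S' hS' hG1
    have hdiv : ∀ x ∈ Ω, euclideanDiv (fun y => F y - G y) x =
        euclideanDiv F x - euclideanDiv G x := by
      intro x hx
      simp only [euclideanDiv, ← Finset.sum_sub_distrib]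
      refine Finset.sum_congr rfl fun j _ => ?_
      have h1 : DifferentiableAt ℝ (fun y => F y j) x :=
        ((contDiffOn_euclidean.1 hF j).contDiffAt (hΩ.mem_nhds hx)).differentiableAt one_ne_zero
      have h2 : DifferentiableAt ℝ (fun y => G y j) x :=
        (contDiff_euclidean.1 hG1 j).differentiable one_ne_zero x
      have h3 := fderiv_fun_sub h1 h2
      simp only [PiLp.sub_apply, h3]
      rfl
    have hdi : IntegrableOn (euclideanDiv fun y => F y - G y) Ω :=
      (hint.sub hGi).congr_fun (fun x hx => (hdiv x hx).symm) hΩ.measurableSet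
    have h1 := abs_integral_euclideanDiv_le hΩ hbdd hne hC (hF.sub hG1.contDiffOn) hε.le
      (fun x hx => hFG x (subset_closure hx)) hdi
    rw [setIntegral_congr_fun hΩ.measurableSet hdiv, integral_sub hint hGi, hGe] at h1
    have h2 : |(S'.integral fun x => contraction (G x)) - S'.integral fun x => contraction (F x)| ≤
        ε * M := by
      simp only [PiecewiseSmoothBoundary.integral, M]
      rw [← Finset.sum_sub_distrib, Finset.mul_sum]
      refine (Finset.abs_sum_le_sum_abs _ _).trans (Finset.sum_le_sum fun i _ => ?_)
      rw [← integral_sub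
        ((S'.continuousOn_contraction_comp hG.continuous.continuousOn i).integrableOn_compact
          (S'.isCompact i))
        ((S'.continuousOn_contraction_comp hFc i).integrableOn_compact (S'.isCompact i)),
        ← integral_const_mul, ← Real.norm_eq_abs]
      have hcof : Continuous fun t => ∑ j, |frameCofactor S' j i t| :=
        continuous_finsetSum _ fun j _ => (continuous_frameCofactor S' j hS' i).abs
      refine norm_integral_le_of_norm_le
        ((hcof.continuousOn.integrableOn_compact (S'.isCompact i)).const_mul ε) ?_
      refine (ae_restrict_iff' (S'.isCompact i).measurableSet).2 (ae_of_all _ fun t ht => ?_)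
      have hcl : S'.φ i t ∈ closure Ω := S'.mapsTo_φ i ht
      rw [contraction_eq_sum (F _), contraction_eq_sum (G _), ← Finset.sum_sub_distrib,
        Finset.mul_sum]
      refine (norm_sum_le _ _).trans (Finset.sum_le_sum fun j _ => ?_)
      rw [← sub_mul, norm_mul]
      refine mul_le_mul_of_nonneg_right ?_ (abs_nonneg _)
      have := PiLp.norm_apply_le (F (S'.φ i t) - G (S'.φ i t)) j
      rw [PiLp.sub_apply, norm_sub_rev] at this
      exact this.trans (hFG _ hcl)
    calc _ = |((∫ x in Ω, euclideanDiv F x) - S'.integral fun x => contraction (G x)) +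
          ((S'.integral fun x => contraction (G x)) - S'.integral fun x => contraction (F x))| := by
          rw [sub_add_sub_cancel]
      _ ≤ _ := (abs_add_le _ _).trans (add_le_add h1 h2)
      _ = ε * B := by simp only [B]; ring
  rw [← sub_eq_zero, ← abs_nonpos_iff]
  refine le_of_forall_pos_le_add fun η hη => ?_
  -- The `+ 1` guards against `B = 0`.
  have := key (η / (B + 1)) (by positivity)
  refine this.trans ?_
  rw [zero_add, div_mul_eq_mul_div, div_le_iff₀ (by positivity)]
  nlinarith

end divergence

/-! ### Homogeneity and vanishing divergence of the generators -/

section group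

variable {N : ℕ}

/-- The dilation as a continuous linear map. -/
noncomputable def dilationCLM (σ : Fin N → ℕ) (l : ℝ) : Pt N →L[ℝ] Pt N :=
  LinearMap.toContinuousLinearMap
    { toFun := dilation σ l
      map_add' := fun x y => by ext; simp [dilation, mul_add]
      map_smul' := fun c x => by ext; simp [dilation, mul_left_comm] }

@[simp]
theorem dilationCLM_apply (σ : Fin N → ℕ) (l : ℝ) (x : Pt N) :
    dilationCLM σ l x = dilation σ l x := rfl

theorem dilation_single (σ : Fin N → ℕ) (l : ℝ) (k : Fin N) :
    dilation σ l (EuclideanSpace.single k 1) = l ^ σ k • EuclideanSpace.single k (1 : ℝ) := by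
  ext i
  by_cases h : i = k
  · subst h; simp [dilation]
  · simp [dilation, h]

theorem tendsto_dilation_zero {σ : Fin N → ℕ} (hσ : ∀ i, 1 ≤ σ i) (x : Pt N) :
    Tendsto (fun l => dilation σ l x) (𝓝 0) (𝓝 0) := by
  have hc : Continuous fun l => dilation σ l x :=
    (PiLp.continuous_toLp 2 _).comp (continuous_pi fun i => by fun_prop)
  have h0 : dilation σ 0 x = 0 := by
    ext i
    simp [dilation, zero_pow (Nat.one_le_iff_ne_zero.1 (hσ i))]
  simpa [h0] using hc.tendsto 0

variable [Group (Pt N)] [LieGroup 𝓘(ℝ, Pt N) ∞ (Pt N)]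

theorem contDiff_group_mul : ContDiff ℝ ∞ fun p : Pt N × Pt N => p.1 * p.2 := by
  have h := contMDiff_mul 𝓘(ℝ, Pt N) ∞ (G := Pt N)
  rw [← modelWithCornersSelf_prod, chartedSpaceSelf_prod] at h
  exact h.contDiff

theorem contDiff_leftField (k : Fin N) : ContDiff ℝ 1 (leftField k : Pt N → Pt N) := by
  have h : ContDiff ℝ 1 fun x : Pt N => fderiv ℝ (fun y : Pt N => x * y) 1 :=
    ContDiff.fderiv (f := fun x y : Pt N => x * y) (m := ∞) (n := 1) contDiff_group_mul contDiff_const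
      (by norm_cast)
  exact h.clm_apply contDiff_const

variable {σ : Fin N → ℕ} (hG : IsHomogeneousCarnotGroup σ)

include hG

theorem dilation_one {l : ℝ} (hl : 0 < l) : dilation σ l (1 : Pt N) = 1 := by
  have h := hG.dilation_mul l hl 1 1
  rw [mul_one] at h
  exact left_eq_mul.1 h

/-- This is the `j`-th component of the derivative, at the identity in the direction `e_k`, of the
automorphism law for dilations; that direction is itself scaled by `l ^ σ k`. -/
theorem leftField_dilation {l : ℝ} (hl : 0 < l) (k j : Fin N) (x : Pt N) :
    l ^ σ k * leftField k (dilation σ l x) j = l ^ σ j * leftField k x j := by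
  have hd : ∀ z : Pt N, Differentiable ℝ fun y : Pt N => z * y := fun z =>
    (contDiff_group_mul.comp (contDiff_const.prodMk contDiff_id)).differentiable (by simp)
  have h1 : HasFDerivAt (fun y : Pt N => dilationCLM σ l (x * y))
      ((dilationCLM σ l).comp (fderiv ℝ (fun y : Pt N => x * y) 1)) 1 :=
    (dilationCLM σ l).hasFDerivAt.comp 1 (hd x 1).hasFDerivAt
  have h2 : HasFDerivAt (fun y : Pt N => dilation σ l x * dilationCLM σ l y)
      ((fderiv ℝ (fun y : Pt N => dilation σ l x * y) 1).comp (dilationCLM σ l)) 1 := by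
    refine HasFDerivAt.comp (g := fun y : Pt N => dilation σ l x * y) 1 ?_
      (dilationCLM σ l).hasFDerivAt
    rw [dilationCLM_apply, dilation_one hG hl]
    exact (hd _ 1).hasFDerivAt
  have heq : (fun y : Pt N => dilationCLM σ l (x * y)) =
      fun y => dilation σ l x * dilationCLM σ l y := funext fun y => hG.dilation_mul l hl x y
  rw [heq] at h1
  have h3 := DFunLike.congr_fun (h1.unique h2) (EuclideanSpace.single k 1)
  simp only [ContinuousLinearMap.comp_apply, dilationCLM_apply, dilation_single, map_smul] at h3
  have h4 := congrArg (fun z : Pt N => z j) h3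
  exact h4.symm

/-- A generator is divergence free; more precisely its coefficient of `∂/∂x_j` does not depend
on `x_j`. -/
theorem fderiv_leftField_single {k : Fin N} (hk : σ k = 1) (j : Fin N) (x : Pt N) :
    fderiv ℝ (fun y : Pt N => leftField k y j) x (EuclideanSpace.single j 1) = 0 := by
  set a : Pt N → ℝ := fun y => leftField k y j
  have ha : ContDiff ℝ 1 a := contDiff_euclidean.1 (contDiff_leftField k) j
  -- The derivative is homogeneous of degree `-1`: differentiating in `x_j` cancels the weight `l ^
  -- σ j` and leaves one factor `l`. As `l → 0` the left side tends to zero by continuity at the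
  -- origin.
  have hscale : ∀ l : ℝ, 0 < l →
      l * fderiv ℝ a (dilation σ l x) (EuclideanSpace.single j 1) =
        fderiv ℝ a x (EuclideanSpace.single j 1) := by
    intro l hl
    have h1 : HasFDerivAt (fun y => l * a (dilationCLM σ l y))
        (l • (fderiv ℝ a (dilation σ l x)).comp (dilationCLM σ l)) x :=
      (HasFDerivAt.comp (g := a) x (ha.differentiable one_ne_zero _).hasFDerivAt
        (dilationCLM σ l).hasFDerivAt).const_mul l
    have h2 : HasFDerivAt (fun y => l ^ σ j * a y) (l ^ σ j • fderiv ℝ a x) x :=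
      (ha.differentiable one_ne_zero _).hasFDerivAt.const_mul _
    have heq : (fun y => l * a (dilationCLM σ l y)) = fun y => l ^ σ j * a y := funext fun y => by
      have := leftField_dilation hG hl k j y
      rwa [hk, pow_one] at this
    rw [heq] at h1
    have h3 := DFunLike.congr_fun (h1.unique h2) (EuclideanSpace.single j 1)
    simp only [_root_.smul_apply, ContinuousLinearMap.comp_apply, dilationCLM_apply,
      dilation_single, map_smul, smul_eq_mul] at h3
    have hpos : l ^ σ j ≠ 0 := (pow_pos hl _).ne'
    refine mul_left_cancel₀ hpos ?_
    rw [← h3]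
    ring
  have hlim : Tendsto (fun l : ℝ => l * fderiv ℝ a (dilation σ l x) (EuclideanSpace.single j 1))
      (𝓝[>] 0) (𝓝 (0 * fderiv ℝ a 0 (EuclideanSpace.single j 1))) := by
    refine Tendsto.mul (tendsto_nhdsWithin_of_tendsto_nhds tendsto_id) ?_
    have hc : Continuous fun y => fderiv ℝ a y (EuclideanSpace.single j 1) :=
      (ha.continuous_fderiv one_ne_zero).clm_apply continuous_const
    exact (hc.tendsto 0).comp ((tendsto_dilation_zero hG.one_le x).mono_left nhdsWithin_le_nhds)
  rw [zero_mul] at hlim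
  refine tendsto_nhds_unique (tendsto_const_nhds.congr' ?_) hlim
  filter_upwards [self_mem_nhdsWithin] with l hl
  exact (hscale l hl).symm

/-- In the product rule the derivatives of the coefficients of the generators drop out, so only the
derivatives of `f k` along the generators remain. -/
theorem euclideanDiv_sum_smul_leftField {f : Fin N → Pt N → ℝ} {x : Pt N}
    (hf : ∀ k, DifferentiableAt ℝ (f k) x) :
    euclideanDiv (fun y => ∑ k with σ k = 1, f k y • leftField k y) x =
      ∑ k with σ k = 1, fderiv ℝ (f k) x (leftField k x) := by
  have ha : ∀ k j, DifferentiableAt ℝ (fun y : Pt N => leftField k y j) x := fun k j =>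
    (contDiff_euclidean.1 (contDiff_leftField k) j).differentiable one_ne_zero x
  have hj : ∀ j, fderiv ℝ (fun y => (∑ k with σ k = 1, f k y • leftField k y : Pt N) j) x
      (EuclideanSpace.single j 1) = ∑ k with σ k = 1,
        leftField k x j * fderiv ℝ (f k) x (EuclideanSpace.single j 1) := by
    intro j
    have h : HasFDerivAt (fun y => ∑ k with σ k = 1, f k y * leftField k y j)
        (∑ k with σ k = 1, (f k x • fderiv ℝ (fun y : Pt N => leftField k y j) x +
          leftField k x j • fderiv ℝ (f k) x)) x :=
      HasFDerivAt.fun_sum fun k _ => (hf k).hasFDerivAt.mul (ha k j).hasFDerivAt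
    have heq : (fun y => (∑ k with σ k = 1, f k y • leftField k y : Pt N) j) =
        fun y => ∑ k with σ k = 1, f k y * leftField k y j := by
      ext y
      simp
    rw [heq, h.fderiv, _root_.sum_apply]
    refine Finset.sum_congr rfl fun k hk => ?_
    rw [_root_.add_apply, _root_.smul_apply,
      _root_.smul_apply, fderiv_leftField_single hG (Finset.mem_filter.1 hk).2,
      smul_zero, zero_add, smul_eq_mul]
  simp only [euclideanDiv, hj]
  rw [Finset.sum_comm]
  refine Finset.sum_congr rfl fun k _ => ?_
  have hw : leftField k x = ∑ j, leftField k x j • EuclideanSpace.single j (1 : ℝ) := by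
    ext a
    simp [Pi.single_apply]
  conv_rhs => rw [hw]
  simp [map_sum]

end group

/-! ### Green's identity in the interior -/

section green

section upToBoundary

variable {N : ℕ} {𝕜 : Type*} [RCLike 𝕜] {Ω : Set (Pt N)} {f : Pt N → 𝕜}

/-- Limits along `Ω` are unique, so the choice made by `extendFrom` does not matter; continuity of
`closureDeriv` is inherited from any `D`. -/
theorem eqOn_closureDeriv {D : Pt N → Pt N →L[ℝ] 𝕜}
    (hD : ContinuousOn D (closure Ω)) (hDf : EqOn D (fderiv ℝ f) Ω) :
    EqOn (closureDeriv Ω f) D (closure Ω) := fun x hx =>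
  extendFrom_eq hx (((hD x hx).mono subset_closure).congr'
    (eventually_nhdsWithin_of_forall fun _ hy => hDf hy))

theorem IsC1UpToBoundary.continuousOn_closureDeriv (hf : IsC1UpToBoundary Ω f) :
    ContinuousOn (closureDeriv Ω f) (closure Ω) := by
  obtain ⟨D, hD, hDf⟩ := hf.exists_extension
  exact hD.congr (eqOn_closureDeriv hD hDf)

theorem IsC1UpToBoundary.closureDeriv_eq (hf : IsC1UpToBoundary Ω f) {x : Pt N} (hx : x ∈ Ω) :
    closureDeriv Ω f x = fderiv ℝ f x := by
  obtain ⟨D, hD, hDf⟩ := hf.exists_extension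
  rw [eqOn_closureDeriv hD hDf (subset_closure hx), hDf hx]

end upToBoundary

variable {N : ℕ} [Group (Pt N)] {𝕜 : Type*} [RCLike 𝕜]

/-- The component along `X_k` of the field `u ∇̃ v - v ∇̃ u` on the closure of `Ω`. -/
noncomputable def greenComponent (Ω : Set (Pt N)) (u v : Pt N → 𝕜) (k : Fin N) (x : Pt N) : 𝕜 :=
  u x * closureDeriv Ω v x (leftField k x) - v x * closureDeriv Ω u x (leftField k x)

variable [LieGroup 𝓘(ℝ, Pt N) ∞ (Pt N)] {Ω : Set (Pt N)} {u v : Pt N → 𝕜}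

theorem continuousOn_greenComponent (hu : IsC1UpToBoundary Ω u) (hv : IsC1UpToBoundary Ω v)
    (k : Fin N) : ContinuousOn (greenComponent Ω u v k) (closure Ω) := by
  have hX : ContinuousOn (leftField k : Pt N → Pt N) (closure Ω) :=
    (contDiff_leftField k).continuous.continuousOn
  exact (hu.continuousOn.mul (hv.continuousOn_closureDeriv.clm_apply hX)).sub
    (hv.continuousOn.mul (hu.continuousOn_closureDeriv.clm_apply hX))

theorem contDiffOn_fieldDeriv (hΩ : IsOpen Ω) (hu : ContDiffOn ℝ 2 u Ω) (k : Fin N) :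
    ContDiffOn ℝ 1 (fieldDeriv k u) Ω :=
  (hu.fderiv_of_isOpen hΩ (by norm_num)).clm_apply (contDiff_leftField k).contDiffOn

omit [LieGroup 𝓘(ℝ, Pt N) ∞ (Pt N)] in
theorem eqOn_greenComponent (hu : IsC1UpToBoundary Ω u) (hv : IsC1UpToBoundary Ω v) (k : Fin N) :
    EqOn (greenComponent Ω u v k) (fun x => u x * fieldDeriv k v x - v x * fieldDeriv k u x) Ω :=
  fun x hx => by
    simp only [greenComponent, fieldDeriv, hu.closureDeriv_eq hx, hv.closureDeriv_eq hx]

theorem contDiffOn_greenComponent (hΩ : IsOpen Ω) (hu2 : ContDiffOn ℝ 2 u Ω)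
    (hu1 : IsC1UpToBoundary Ω u) (hv2 : ContDiffOn ℝ 2 v Ω) (hv1 : IsC1UpToBoundary Ω v)
    (k : Fin N) : ContDiffOn ℝ 1 (greenComponent Ω u v k) Ω :=
  ((hu1.contDiffOn.mul (contDiffOn_fieldDeriv hΩ hv2 k)).sub
    (hv1.contDiffOn.mul (contDiffOn_fieldDeriv hΩ hu2 k))).congr (eqOn_greenComponent hu1 hv1 k)

/-- Green's identity in divergence form. -/
theorem sum_fieldDeriv_greenComponent (σ : Fin N → ℕ) (hΩ : IsOpen Ω) (hu2 : ContDiffOn ℝ 2 u Ω)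
    (hu1 : IsC1UpToBoundary Ω u) (hv2 : ContDiffOn ℝ 2 v Ω) (hv1 : IsC1UpToBoundary Ω v)
    {x : Pt N} (hx : x ∈ Ω) :
    ∑ k with σ k = 1, fieldDeriv k (greenComponent Ω u v k) x =
      u x * subLaplacian σ v x - v x * subLaplacian σ u x := by
  have hd : ∀ w : Pt N → 𝕜, ContDiffOn ℝ 1 w Ω → HasFDerivAt w (fderiv ℝ w x) x := fun w hw =>
    ((hw.contDiffAt (hΩ.mem_nhds hx)).differentiableAt one_ne_zero).hasFDerivAt
  simp only [subLaplacian, Finset.mul_sum, ← Finset.sum_sub_distrib]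
  refine Finset.sum_congr rfl fun k _ => ?_
  have hev := (eqOn_greenComponent hu1 hv1 k).eventuallyEq_of_mem (hΩ.mem_nhds hx)
  have h := ((hd u hu1.contDiffOn).mul (hd _ (contDiffOn_fieldDeriv hΩ hv2 k))).sub
    ((hd v hv1.contDiffOn).mul (hd _ (contDiffOn_fieldDeriv hΩ hu2 k)))
  have h' := congrArg (fun D : Pt N →L[ℝ] 𝕜 => D (leftField k x)) (hev.fderiv_eq.trans h.fderiv)
  simp only [_root_.sub_apply, _root_.add_apply, _root_.smul_apply, smul_eq_mul] at h'
  change fderiv ℝ (greenComponent Ω u v k) x (leftField k x) = _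
  rw [h']
  -- The two products of first derivatives, one from each half of the component, cancel.
  change u x * fieldDeriv k (fieldDeriv k v) x + fieldDeriv k v x * fieldDeriv k u x -
    (v x * fieldDeriv k (fieldDeriv k u) x + fieldDeriv k u x * fieldDeriv k v x) = _
  ring

end green

/-! ### The boundary form and the reduction to real fields -/

section boundary

variable {n : ℕ} [Group (Pt (n + 1))] {𝕜 : Type*} [RCLike 𝕜] {Ω : Set (Pt (n + 1))}
  {u v : Pt (n + 1) → 𝕜} (σ : Fin (n + 1) → ℕ)

/-- This exhibits the boundary integrand as the flux of the field with components `greenComponent`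
along the generators, the shape required by the divergence theorem. -/
theorem green_form_apply (x : Pt (n + 1)) (w : Fin n → Pt (n + 1)) :
    (u x • gradForm σ Ω v x - v x • gradForm σ Ω u x) w =
      ∑ k with σ k = 1, contraction (leftField k x) w • greenComponent Ω u v k x := by
  have h : ∀ f : Pt (n + 1) → 𝕜, gradForm σ Ω f x w =
      ∑ k with σ k = 1, contraction (leftField k x) w • closureDeriv Ω f x (leftField k x) := by
    intro f
    rw [gradForm]
    generalize (Finset.univ.filter fun k => σ k = 1) = s
    induction s using Finset.induction_on with
    | empty => simp
    | insert a s ha ih =>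
      rw [Finset.sum_insert ha, Finset.sum_insert ha, AlternatingMap.add_apply, ih]
      rfl
  rw [AlternatingMap.sub_apply, AlternatingMap.smul_apply, AlternatingMap.smul_apply, h, h,
    smul_eq_mul, smul_eq_mul, Finset.mul_sum, Finset.mul_sum, ← Finset.sum_sub_distrib]
  refine Finset.sum_congr rfl fun k _ => ?_
  rw [greenComponent, smul_sub, mul_smul_comm, mul_smul_comm]

variable [LieGroup 𝓘(ℝ, Pt (n + 1)) ∞ (Pt (n + 1))]

variable {σ}

/-- Green's second formula after the application of a real linear functional to the values. -/
theorem clm_setIntegral_green (hG : IsHomogeneousCarnotGroup σ) (hΩ : IsOpen Ω)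
    (hbdd : Bornology.IsBounded Ω) (S : PiecewiseSmoothBoundary Ω)
    (hu2 : ContDiffOn ℝ 2 u Ω) (hu1 : IsC1UpToBoundary Ω u)
    (hv2 : ContDiffOn ℝ 2 v Ω) (hv1 : IsC1UpToBoundary Ω v)
    (hint : IntegrableOn
      (fun x => u x * subLaplacian σ v x - v x * subLaplacian σ u x) Ω volume) (ℓ : 𝕜 →L[ℝ] ℝ) :
    ℓ (∫ x in Ω, (u x * subLaplacian σ v x - v x * subLaplacian σ u x)) =
      ℓ (S.integral (fun x => u x • gradForm σ Ω v x - v x • gradForm σ Ω u x)) := by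
  -- The divergence theorem concerns real fields, so `ℓ` is applied to the scalar components; it
  -- commutes with the real generators and with integration.
  set F : Pt (n + 1) → Pt (n + 1) := fun x =>
    ∑ k with σ k = 1, ℓ (greenComponent Ω u v k x) • leftField k x
  have hX : ∀ k, ContDiff ℝ 1 (leftField k : Pt (n + 1) → Pt (n + 1)) := contDiff_leftField
  have hFc : ContinuousOn F (closure Ω) := continuousOn_finsetSum _ fun k _ =>
    (ℓ.continuous.comp_continuousOn (continuousOn_greenComponent hu1 hv1 k)).smul
      (hX k).continuous.continuousOn
  have hcomp : ∀ k, ContDiffOn ℝ 1 (greenComponent Ω u v k) Ω :=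
    contDiffOn_greenComponent hΩ hu2 hu1 hv2 hv1
  have hF : ContDiffOn ℝ 1 F Ω := ContDiffOn.sum fun k _ =>
    (ℓ.contDiff.comp_contDiffOn (hcomp k)).smul (hX k).contDiffOn
  have hdiv : EqOn (euclideanDiv F)
      (fun x => ℓ (u x * subLaplacian σ v x - v x * subLaplacian σ u x)) Ω := by
    intro x hx
    have hd : ∀ k, DifferentiableAt ℝ (greenComponent Ω u v k) x := fun k =>
      ((hcomp k).contDiffAt (hΩ.mem_nhds hx)).differentiableAt one_ne_zero
    have h1 : ∀ k, HasFDerivAt (fun y => ℓ (greenComponent Ω u v k y))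
        (ℓ.comp (fderiv ℝ (greenComponent Ω u v k) x)) x := fun k =>
      ℓ.hasFDerivAt.comp x (hd k).hasFDerivAt
    simp only [F]
    rw [euclideanDiv_sum_smul_leftField hG fun k => (h1 k).differentiableAt,
      ← sum_fieldDeriv_greenComponent σ hΩ hu2 hu1 hv2 hv1 hx, map_sum]
    refine Finset.sum_congr rfl fun k _ => ?_
    rw [(h1 k).fderiv]
    rfl
  have hdi : IntegrableOn (euclideanDiv F) Ω :=
    IntegrableOn.congr_fun (ℓ.integrable_comp hint) (fun x hx => (hdiv hx).symm) hΩ.measurableSet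
  have hmain := setIntegral_euclideanDiv_eq hΩ hbdd S hFc hF hdi
  rw [← ℓ.integral_comp_comm hint, ← setIntegral_congr_fun hΩ.measurableSet hdiv, hmain]
  simp only [PiecewiseSmoothBoundary.integral, map_sum]
  refine Finset.sum_congr rfl fun i _ => ?_
  have hi : IntegrableOn (fun t => (u (S.φ i t) • gradForm σ Ω v (S.φ i t) -
      v (S.φ i t) • gradForm σ Ω u (S.φ i t)) (tangentFrame (S.φ i) t)) (S.K i) := by
    refine ContinuousOn.integrableOn_compact (S.isCompact i) ?_
    simp only [green_form_apply]
    refine continuousOn_finsetSum _ fun k _ => ContinuousOn.smul ?_ ?_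
    · exact S.continuousOn_contraction_comp (hX k).continuous.continuousOn i
    · exact (continuousOn_greenComponent hu1 hv1 k).comp (S.continuousOn_φ i) (S.mapsTo_φ i)
  rw [← ℓ.integral_comp_comm hi]
  refine integral_congr_ae (ae_of_all _ fun t => ?_)
  simp only [green_form_apply, map_sum, map_smul]
  change contractionApply _ (F _) = _
  simp only [F, map_sum, map_smul, smul_eq_mul]
  refine Finset.sum_congr rfl fun k _ => ?_
  exact mul_comm _ _

end boundary

end Carnot

theorem proposition2p9 {n : ℕ} [Group (Carnot.Pt (n + 1))]
    [LieGroup 𝓘(ℝ, Carnot.Pt (n + 1)) ∞ (Carnot.Pt (n + 1))]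
    (σ : Fin (n + 1) → ℕ) (hG : Carnot.IsHomogeneousCarnotGroup σ)
    (hQ : 3 ≤ Carnot.homogeneousDimension σ)
    (Ω : Set (Carnot.Pt (n + 1))) (hΩ : IsOpen Ω) (hbdd : Bornology.IsBounded Ω)
    (S : Carnot.PiecewiseSmoothBoundary Ω)
    {𝕜 : Type*} [RCLike 𝕜] (u v : Carnot.Pt (n + 1) → 𝕜)
    (hu2 : ContDiffOn ℝ 2 u Ω) (hu1 : Carnot.IsC1UpToBoundary Ω u)
    (hv2 : ContDiffOn ℝ 2 v Ω) (hv1 : Carnot.IsC1UpToBoundary Ω v)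
    (hint : IntegrableOn
      (fun x => u x * Carnot.subLaplacian σ v x - v x * Carnot.subLaplacian σ u x) Ω volume) :
    ∫ x in Ω, (u x * Carnot.subLaplacian σ v x - v x * Carnot.subLaplacian σ u x) =
      S.integral (fun x => u x • Carnot.gradForm σ Ω v x - v x • Carnot.gradForm σ Ω u x) := by
  have h := Carnot.clm_setIntegral_green hG hΩ hbdd S hu2 hu1 hv2 hv1 hint
  exact RCLike.ext (h RCLike.reCLM) (h RCLike.imCLM)
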